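/- Let $\mathcal H_1,\mathcal H_2$ be complex Hilbert spaces of finite dimensions $d_1,d_2\ge 1$, identified by orthonormal bases with $\mathbb C^{d_1},\mathbb C^{d_2}$. Let $H(\mathcal H)$ be the set of Hermitian operators (matrices) on $\mathcal H$, and let $\mathfrak P(\mathcal H)$ be the set of positive semi-definite ones of trace $1$. Let $\varepsilon>0$, let $C\in H(\mathcal H_1\otimes\mathcal H_2)$, and let $\rho\in\mathfrak P(\mathcal H_1)$, $\sigma\in\mathfrak P(\mathcal H_2)$ be positive definite. For $U\in H(\mathcal H_1)$ and $V\in H(\mathcal H_2)$ put $U\oplus V=U\otimes \mathrm{id}+\mathrm{id}\otimes V$. Write $\operatorname{tr}_2$ and $\operatorname{tr}_1$ for the partial traces from $H(\mathcal H_1\otimes\mathcal H_2)$ to $H(\mathcal H_1)$ and $H(\mathcal H_2)$ (tracing out the second, respectively the first, factor). The primal problem is to minimise $$F(\Gamma)=\operatorname{tr}(C\Gamma)+\varepsilon\operatorname{tr}(\Gamma\log\Gamma)\qquad(0\log 0=0)$$ over all $\Gamma\in\mathfrak P(\mathcal H_1\otimes\mathcal H_2)$ with $\operatorname{tr}_2\Gamma=\rho$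 and $\operatorname{tr}_1\Gamma=\sigma$. The dual functional, on $H(\mathcal H_1)\times H(\mathcal H_2)$, is $$D(U,V)=\operatorname{tr}(U\rho)+\operatorname{tr}(V\sigma)-\varepsilon\operatorname{tr}\exp\Big(\frac{U\oplus V-C}{\varepsilon}\Big)+\varepsilon .$$ Let $U_0\in H(\mathcal H_1)$, $V_0\in H(\mathcal H_2)$ be arbitrary. Let $\nu_2:[0,\infty)\to[0,\infty)$ be the inverse of $x\mapsto e^x-x-1$, and put $$\beta=\nu_2\Big(\frac{\operatorname{tr}((\rho\otimes\sigma)C)-D(U_0,V_0)}{\varepsilon}\Big),\qquad \eta_1=\frac{\varepsilon}{d_2}e^{-\beta},\qquad \eta_2=\frac{\varepsilon}{d_1}e^{-\beta}.$$ For $n\ge 0$ define $$U_{n+1}=U_n+\eta_1\Big(\rho-\operatorname{tr}_2\exp\Big(\frac{U_n\oplus V_n-C}{\varepsilon}\Big)\Big),\qquad V_{n+1}=V_n+\eta_2\Big(\sigma-\operatorname{tr}_1\exp\Big(\frac{U_{n+1}\oplus V_n-C}{\varepsilon}\Big)\Big).$$ **Theorem.** There are $\hat U\in H(\mathcal H_1)$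 and $\hat V\in H(\mathcal H_2)$ such that $U_n\oplus V_n\to\hat U\oplus\hat V$ as $n\to\infty$. Here $(\hat U,\hat V)$ maximises $D$ over $H(\mathcal H_1)\times H(\mathcal H_2)$, and $\exp\big((\hat U\oplus\hat V-C)/\varepsilon\big)$ is the unique minimiser of the primal problem. The convergence is at least linear: $$\liminf_{n\to\infty}\,-\frac1n\log\Big\|\exp\Big(\frac{U_n\oplus V_n-C}{\varepsilon}\Big)-\exp\Big(\frac{\hat U\oplus\hat V-C}{\varepsilon}\Big)\Big\|>0 ,$$ where $\|\cdot\|$ is the Hilbert–Schmidt norm (the choice of norm is immaterial in finite dimension), $\log 0=-\infty$, and the value $+\infty$ of the $\liminf$ is allowed. -/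

import Mathlib

open scoped Kronecker ComplexOrder

namespace QOT

noncomputable section

variable {m n ι : Type*} [Fintype m] [DecidableEq m] [Fintype n] [DecidableEq n]
  [Fintype ι] [DecidableEq ι]

/-- Quantum states (density matrices): positive semi-definite matrices of trace `1`. -/
def IsState (Γ : Matrix ι ι ℂ) : Prop :=
  Γ.PosSemidef ∧ Γ.trace = 1

/-- The tensor sum `U ⊗ id + id ⊗ V`, a matrix acting on the tensor product space, whose
standard basis is indexed by `m × n`. -/
def tensorSum (U : Matrix m m ℂ) (V : Matrix n n ℂ) : Matrix (m × n) (m × n) ℂ :=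
  U ⊗ₖ (1 : Matrix n n ℂ) + (1 : Matrix m m ℂ) ⊗ₖ V

/-- The first partial trace `tr₂ Γ`: the second factor is traced out. -/
def partialTrace₂ (Γ : Matrix (m × n) (m × n) ℂ) : Matrix m m ℂ :=
  Matrix.of fun i i' => ∑ j, Γ (i, j) (i', j)

/-- The second partial trace `tr₁ Γ`: the first factor is traced out. -/
def partialTrace₁ (Γ : Matrix (m × n) (m × n) ℂ) : Matrix n n ℂ :=
  Matrix.of fun j j' => ∑ i, Γ (i, j) (i, j')

/-- The duality that characterises the first partial trace. -/
theorem trace_partialTrace₂_mul {m n : Type*} [Fintype m] [Fintype n] [DecidableEq n]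
    (Γ : Matrix (m × n) (m × n) ℂ) (A : Matrix m m ℂ) :
    (partialTrace₂ Γ * A).trace = (Γ * (A ⊗ₖ (1 : Matrix n n ℂ))).trace := by
  simp only [Matrix.trace, Matrix.diag, Matrix.mul_apply, partialTrace₂, Matrix.of_apply,
    Fintype.sum_prod_type, Matrix.kroneckerMap_apply, Matrix.one_apply, mul_ite, mul_one, mul_zero,
    Finset.sum_ite_eq', Finset.mem_univ, if_true, Finset.sum_mul]
  exact Finset.sum_congr rfl fun i _ => Finset.sum_comm

/-- The duality that characterises the second partial trace. -/
theorem trace_partialTrace₁_mul {m n : Type*} [Fintype m] [DecidableEq m] [Fintype n]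
    (Γ : Matrix (m × n) (m × n) ℂ) (B : Matrix n n ℂ) :
    (partialTrace₁ Γ * B).trace = (Γ * ((1 : Matrix m m ℂ) ⊗ₖ B)).trace := by
  simp only [Matrix.trace, Matrix.diag, Matrix.mul_apply, partialTrace₁, Matrix.of_apply,
    Fintype.sum_prod_type, Matrix.kroneckerMap_apply, Matrix.one_apply, ite_mul, mul_ite, one_mul,
    zero_mul, mul_zero, Finset.sum_mul]
  have h : ∀ (i : m) (j : n), (∑ i', ∑ j', if i' = i then Γ (i, j) (i', j') * B j' j else 0) =
      ∑ j', Γ (i, j) (i, j') * B j' j := fun i j => by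
    rw [Finset.sum_comm]
    simp
  simp only [h]
  rw [Finset.sum_comm (s := (Finset.univ : Finset m))]
  exact Finset.sum_congr rfl fun j _ => Finset.sum_comm

/-- The Hilbert-Schmidt (Frobenius) norm `√(tr (A† A))`. -/
def hsNorm (A : Matrix ι ι ℂ) : ℝ :=
  Real.sqrt (A.conjTranspose * A).trace.re

/-- The negative von Neumann entropy `tr (Γ log Γ)`; here `log` is lifted to Hermitian matrices
by the functional calculus, and `Real.log 0 = 0` gives the convention `0 log 0 = 0`. -/
def negEntropy (Γ : Matrix ι ι ℂ) : ℝ :=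
  (Γ * cfc Real.log Γ).trace.re

/-- The primal functional `F(Γ) = tr (C Γ) + ε S(Γ)`. -/
def primal (ε : ℝ) (C Γ : Matrix (m × n) (m × n) ℂ) : ℝ :=
  (C * Γ).trace.re + ε * negEntropy Γ

/-- Quantum states of the composite system with sub-states `ρ` and `σ`. -/
def IsCoupling (ρ : Matrix m m ℂ) (σ : Matrix n n ℂ) (Γ : Matrix (m × n) (m × n) ℂ) : Prop :=
  IsState Γ ∧ partialTrace₂ Γ = ρ ∧ partialTrace₁ Γ = σ

/-- `Γ` solves the entropically regularised quantum optimal transport problem. -/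
def IsPrimalMinimiser (ε : ℝ) (ρ : Matrix m m ℂ) (σ : Matrix n n ℂ)
    (C Γ : Matrix (m × n) (m × n) ℂ) : Prop :=
  IsCoupling ρ σ Γ ∧ ∀ Γ' : Matrix (m × n) (m × n) ℂ, IsCoupling ρ σ Γ' →
    primal ε C Γ ≤ primal ε C Γ'

/-- The matrix `exp ((U ⊕ V - C) / ε)`. -/
def gibbs (ε : ℝ) (C : Matrix (m × n) (m × n) ℂ) (U : Matrix m m ℂ) (V : Matrix n n ℂ) :
    Matrix (m × n) (m × n) ℂ :=
  NormedSpace.exp (ε⁻¹ • (tensorSum U V - C))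

/-- The dual functional `D(U, V)`. -/
def dual (ε : ℝ) (ρ : Matrix m m ℂ) (σ : Matrix n n ℂ) (C : Matrix (m × n) (m × n) ℂ)
    (U : Matrix m m ℂ) (V : Matrix n n ℂ) : ℝ :=
  (U * ρ).trace.re + (V * σ).trace.re - ε * (gibbs ε C U V).trace.re + ε

/-- `(U, V)` maximises the dual functional over pairs of Hermitian matrices. -/
def IsDualMaximiser (ε : ℝ) (ρ : Matrix m m ℂ) (σ : Matrix n n ℂ)
    (C : Matrix (m × n) (m × n) ℂ) (U : Matrix m m ℂ) (V : Matrix n n ℂ) : Prop :=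
  U.IsHermitian ∧ V.IsHermitian ∧
    ∀ (U' : Matrix m m ℂ) (V' : Matrix n n ℂ), U'.IsHermitian → V'.IsHermitian →
      dual ε ρ σ C U' V' ≤ dual ε ρ σ C U V

/-- The function `ν₂ : [0, ∞) → [0, ∞)` inverse to `x ↦ exp x - x - 1`. -/
def nu₂ : ℝ → ℝ :=
  Function.invFunOn (fun x : ℝ => Real.exp x - x - 1) (Set.Ici 0)

/-- The number `β = ν₂ ((tr ((ρ ⊗ σ) C) - D(U₀, V₀)) / ε)` computed from the initial values. -/
def bgaBeta (ε : ℝ) (ρ : Matrix m m ℂ) (σ : Matrix n n ℂ) (C : Matrix (m × n) (m × n) ℂ)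
    (U₀ : Matrix m m ℂ) (V₀ : Matrix n n ℂ) : ℝ :=
  nu₂ ((((ρ ⊗ₖ σ) * C).trace.re - dual ε ρ σ C U₀ V₀) / ε)

/-- One update of the block gradient ascent method with step sizes `η₁` and `η₂`: first `U` is
updated, then `V`, using the new value of `U`. -/
def bgaStep (ε : ℝ) (ρ : Matrix m m ℂ) (σ : Matrix n n ℂ) (C : Matrix (m × n) (m × n) ℂ)
    (η₁ η₂ : ℝ) (p : Matrix m m ℂ × Matrix n n ℂ) : Matrix m m ℂ × Matrix n n ℂ :=
  let U' := p.1 + η₁ • (ρ - partialTrace₂ (gibbs ε C p.1 p.2))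
  (U', p.2 + η₂ • (σ - partialTrace₁ (gibbs ε C U' p.2)))

/-- The iterates `(U_k, V_k)` of the block gradient ascent method started at `(U₀, V₀)`, with step
sizes `η₁ = (ε / d₂) exp (-β)` and `η₂ = (ε / d₁) exp (-β)`. -/
def bga (ε : ℝ) (ρ : Matrix m m ℂ) (σ : Matrix n n ℂ) (C : Matrix (m × n) (m × n) ℂ)
    (U₀ : Matrix m m ℂ) (V₀ : Matrix n n ℂ) : ℕ → Matrix m m ℂ × Matrix n n ℂ
  | 0 => (U₀, V₀)
  | k + 1 =>
    bgaStep ε ρ σ C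
      (ε / Fintype.card n * Real.exp (-bgaBeta ε ρ σ C U₀ V₀))
      (ε / Fintype.card m * Real.exp (-bgaBeta ε ρ σ C U₀ V₀))
      (bga ε ρ σ C U₀ V₀ k)

end

end QOT

/-! Write `A = (U ⊕ V - C)/ε` and `ω = ρ ⊗ σ`. By `dual_eq` the dual is `tr (ωC) - ε G(A)` with
`G(A) = tr exp A - tr (ωA) - 1` (`dualGap`), so the method is block gradient descent for a convex
function on an affine space of Hermitian matrices.

In an eigenbasis of `A`, with eigenvalues `λ_j` and diagonal entries `p_j` of `ω`, `G(A)` is the sum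
of the terms `exp λ_j - p_j (λ_j + 1)`, all nonnegative because `0 ≤ p_j ≤ 1`. On `{G ≤ Q}` each
term is at most `Q`, which gives `λ_j ≤ ν₂(Q)` and, when `ω ≥ c > 0`, `λ_j ≥ -Q/c - 1`. Sublevel
sets are therefore compact, a minimiser exists, and with `Q` the initial gap (so `β = ν₂(Q)`) `G` is
`exp β`-smooth and `exp (-Q/c - 1)`-strongly convex there.

The step sizes are inverse block smoothness constants, and `dualGap_step_le` shows that a step
decreases `G` without leaving the sublevel set. Strong convexity bounds the excess of `G` by the
squared gradient (`dualGap_sub_le`), and `trForm_gradRight_le` corrects for the second block being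
updated at the new `U`. Together they contract the excess (`dualGap_bga_succ_le`); strong convexity
and Lipschitz continuity of `exp` then carry the rate over to the exponents and the Gibbs matrices.

At a minimiser both partial gradients vanish, so the Gibbs matrix is a coupling. Klein's inequality
and its equality case give duality and uniqueness of the primal minimiser. -/

namespace QOT

/-! ### Scalar inequalities for the exponential and `ν₂` -/

section Scalar

/-- Second order Taylor expansion of the exponential with Lagrange remainder. -/
theorem exists_exp_sub_taylor_eq (a b : ℝ) : ∃ c ∈ Set.uIcc a b,
    Real.exp b - Real.exp a - Real.exp a * (b - a) = Real.exp c / 2 * (b - a) ^ 2 := by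
  rcases eq_or_ne a b with rfl | hab
  · exact ⟨a, by simp, by simp⟩
  have hu : UniqueDiffOn ℝ (Set.uIcc a b) := uniqueDiffOn_Icc (by simpa [eq_comm] using hab)
  have hd : ∀ k, ∀ x ∈ Set.uIcc a b,
      iteratedDerivWithin k Real.exp (Set.uIcc a b) x = Real.exp x := fun k x hx => by
    rw [iteratedDerivWithin_eq_iteratedDeriv hu Real.contDiff_exp.contDiffAt hx,
      iteratedDeriv_eq_iterate, Real.iter_deriv_exp]
  obtain ⟨c, hc, h⟩ := taylor_mean_remainder_lagrange (f := Real.exp) (n := 1) hab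
    Real.contDiff_exp.contDiffOn
    (Real.differentiable_exp.differentiableOn.congr fun x hx => hd 1 x (Set.uIoo_subset_uIcc_self hx))
  have hc' := Set.uIoo_subset_uIcc_self hc
  refine ⟨c, hc', ?_⟩
  rw [hd _ c hc', taylorWithinEval_succ, taylor_within_zero_eval, hd _ a Set.left_mem_uIcc] at h
  norm_num at h
  linarith

theorem exp_bregman_le {a b M : ℝ} (ha : a ≤ M) (hb : b ≤ M) :
    Real.exp b - Real.exp a - Real.exp a * (b - a) ≤ Real.exp M / 2 * (b - a) ^ 2 := by
  obtain ⟨c, hc, h⟩ := exists_exp_sub_taylor_eq a b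
  rw [h]
  have : c ≤ M := hc.2.trans (max_le ha hb)
  gcongr

theorem le_exp_bregman {a b M : ℝ} (ha : M ≤ a) (hb : M ≤ b) :
    Real.exp M / 2 * (b - a) ^ 2 ≤ Real.exp b - Real.exp a - Real.exp a * (b - a) := by
  obtain ⟨c, hc, h⟩ := exists_exp_sub_taylor_eq a b
  rw [h]
  have : M ≤ c := (le_min ha hb).trans hc.1
  gcongr

theorem sq_exp_sub_exp_le {a b M : ℝ} (ha : a ≤ M) (hb : b ≤ M) :
    (Real.exp a - Real.exp b) ^ 2 ≤ Real.exp M ^ 2 * (a - b) ^ 2 := by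
  rw [← mul_pow, sq_le_sq, abs_mul, abs_of_pos (Real.exp_pos M)]
  wlog h : b ≤ a generalizing a b
  · rw [abs_sub_comm, abs_sub_comm a]
    exact this hb ha (le_of_not_ge h)
  rw [abs_of_nonneg (sub_nonneg.2 (Real.exp_le_exp.2 h)), abs_of_nonneg (sub_nonneg.2 h)]
  have h1 : Real.exp b = Real.exp a * Real.exp (b - a) := by rw [← Real.exp_add]; ring_nf
  have h2 := Real.add_one_le_exp (b - a)
  have h3 := Real.exp_le_exp.2 ha
  have h4 := Real.exp_pos a
  nlinarith [mul_nonneg h4.le (sub_nonneg.2 h2), mul_nonneg (sub_nonneg.2 h3) (sub_nonneg.2 h)]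

/-- This is `log y ≤ y - 1` at `y = exp a / p`, multiplied by `p`; at `p = 0` only `exp a` remains.
-/
theorem klein_scalar_nonneg {p : ℝ} (hp : 0 ≤ p) (a : ℝ) :
    0 ≤ p * Real.log p - p * a + Real.exp a - p := by
  rcases hp.eq_or_lt with rfl | hp
  · simpa using (Real.exp_pos a).le
  have h := Real.log_le_sub_one_of_pos (div_pos (Real.exp_pos a) hp)
  rw [Real.log_div (Real.exp_pos a).ne' hp.ne', Real.log_exp, ← sub_nonneg] at h
  have := mul_nonneg hp.le h
  have e : p * (Real.exp a / p) = Real.exp a := by field_simp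
  nlinarith

theorem eq_exp_of_klein_scalar_eq_zero {p : ℝ} (hp : 0 ≤ p) {a : ℝ}
    (h0 : p * Real.log p - p * a + Real.exp a - p = 0) : p = Real.exp a := by
  rcases hp.eq_or_lt with rfl | hp
  · simp at h0
  by_contra hne
  have h := Real.log_lt_sub_one_of_pos (div_pos (Real.exp_pos a) hp)
    (by rw [Ne, div_eq_one_iff_eq hp.ne']; exact Ne.symm hne)
  rw [Real.log_div (Real.exp_pos a).ne' hp.ne', Real.log_exp, ← sub_pos] at h
  have := mul_pos hp h
  have e : p * (Real.exp a / p) = Real.exp a := by field_simp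
  nlinarith

theorem nu₂_spec {Q : ℝ} (hQ : 0 ≤ Q) :
    0 ≤ nu₂ Q ∧ Real.exp (nu₂ Q) - nu₂ Q - 1 = Q := by
  have h : ∃ x ∈ Set.Ici (0 : ℝ), Real.exp x - x - 1 = Q := by
    have hc : ContinuousOn (fun x : ℝ => Real.exp x - x - 1) (Set.Icc 0 (Q + 2)) := by fun_prop
    -- At the right endpoint `exp x - x - 1 ≥ x² / 2 = (Q + 2)² / 2 ≥ Q`.
    have hq := Real.quadratic_le_exp_of_nonneg (x := Q + 2) (by linarith)
    obtain ⟨x, hx, h⟩ := intermediate_value_Icc (by linarith) hc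
      (show Q ∈ Set.Icc _ _ from ⟨by simpa using hQ, by nlinarith⟩)
    exact ⟨x, hx.1, h⟩
  exact ⟨Function.invFunOn_mem h, Function.invFunOn_eq h⟩

/-- Follows from strict monotonicity of `exp x - x - 1` on `[0, ∞)`. Negative `x` needs no
hypothesis because `ν₂` is nonnegative. -/
theorem le_nu₂ {Q x : ℝ} (hQ : 0 ≤ Q) (hx : 0 ≤ x → Real.exp x - x - 1 ≤ Q) : x ≤ nu₂ Q := by
  obtain ⟨h0, h1⟩ := nu₂_spec hQ
  by_contra! hlt
  have h2 := hx (h0.trans hlt.le)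
  have h3 := Real.add_one_lt_exp (sub_pos.2 hlt).ne'
  have h4 : Real.exp x = Real.exp (nu₂ Q) * Real.exp (x - nu₂ Q) := by rw [← Real.exp_add]; ring_nf
  have h5 := Real.one_le_exp h0
  nlinarith [mul_nonneg (sub_nonneg.2 h5) (sub_nonneg.2 (Real.one_le_exp (sub_nonneg.2 hlt.le)))]

end Scalar

/-! ### Trace identities in a pair of eigenbases -/

section Spectral

variable {ι : Type*} [Fintype ι]

/-- The real bilinear form `Re tr (X Y)`, the Hilbert-Schmidt inner product on Hermitian
matrices. -/
noncomputable def trForm : Matrix ι ι ℂ →ₗ[ℝ] Matrix ι ι ℂ →ₗ[ℝ] ℝ :=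
  LinearMap.mk₂ ℝ (fun X Y => (X * Y).trace.re)
    (by simp [add_mul]) (by simp) (by simp [mul_add]) (by simp)

theorem trForm_apply (X Y : Matrix ι ι ℂ) : trForm X Y = (X * Y).trace.re := rfl

theorem trForm_comm (X Y : Matrix ι ι ℂ) : trForm X Y = trForm Y X := by
  rw [trForm_apply, trForm_apply, Matrix.trace_mul_comm]

theorem trForm_self_eq {X : Matrix ι ι ℂ} (hX : X.IsHermitian) :
    trForm X X = ∑ i, ∑ j, Complex.normSq (X i j) := by
  rw [trForm_apply]
  simp only [Matrix.trace, Matrix.diag, Matrix.mul_apply, Complex.re_sum]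
  refine Finset.sum_congr rfl fun i _ => Finset.sum_congr rfl fun j _ => ?_
  rw [← hX.apply j i, Complex.star_def, Complex.mul_conj, Complex.ofReal_re]

theorem normSq_apply_le_trForm_self {X : Matrix ι ι ℂ} (hX : X.IsHermitian) (i j : ι) :
    Complex.normSq (X i j) ≤ trForm X X := by
  rw [trForm_self_eq hX]
  exact (Finset.single_le_sum (f := fun j => Complex.normSq (X i j))
    (fun j _ => Complex.normSq_nonneg _) (Finset.mem_univ j)).trans
    (Finset.single_le_sum (f := fun i => ∑ j, Complex.normSq (X i j))
      (fun i _ => Finset.sum_nonneg fun j _ => Complex.normSq_nonneg _) (Finset.mem_univ i))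

theorem trForm_self_nonneg {X : Matrix ι ι ℂ} (hX : X.IsHermitian) : 0 ≤ trForm X X := by
  rw [trForm_self_eq hX]
  exact Finset.sum_nonneg fun i _ => Finset.sum_nonneg fun j _ => Complex.normSq_nonneg _

theorem eq_zero_of_trForm_self_le {X : Matrix ι ι ℂ} (hX : X.IsHermitian) (h : trForm X X ≤ 0) :
    X = 0 := by
  ext i j
  exact Complex.normSq_eq_zero.1
    (((normSq_apply_le_trForm_self hX i j).trans h).antisymm (Complex.normSq_nonneg _))

theorem hsNorm_eq {X : Matrix ι ι ℂ} (hX : X.IsHermitian) : hsNorm X = Real.sqrt (trForm X X) := by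
  rw [hsNorm, hX.eq, trForm_apply]

variable [DecidableEq ι] {A B : Matrix ι ι ℂ}

theorem cfc_id_eq (hA : A.IsHermitian) : hA.cfc id = A := by
  conv_rhs => rw [hA.spectral_theorem]
  rfl

theorem cfc_one_eq (hA : A.IsHermitian) : hA.cfc (fun _ => 1) = 1 := by
  have : Matrix.diagonal ((RCLike.ofReal : ℝ → ℂ) ∘ (fun _ => 1) ∘ hA.eigenvalues) = 1 := by
    rw [← Matrix.diagonal_one]; exact congrArg Matrix.diagonal (by ext; simp)
  rw [Matrix.IsHermitian.cfc, this, map_one]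

theorem cfc_exp_eq (hA : A.IsHermitian) : hA.cfc Real.exp = NormedSpace.exp A := by
  conv_rhs => rw [hA.spectral_theorem]
  rw [Matrix.IsHermitian.cfc, Unitary.conjStarAlgAut_apply, Unitary.conjStarAlgAut_apply]
  have hinv : ((star hA.eigenvectorUnitary : unitary (Matrix ι ι ℂ)) : Matrix ι ι ℂ) =
      (hA.eigenvectorUnitary : Matrix ι ι ℂ)⁻¹ :=
    (Matrix.inv_eq_right_inv (Unitary.coe_mul_star_self _)).symm
  have hu : IsUnit (hA.eigenvectorUnitary : Matrix ι ι ℂ) :=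
    IsUnit.of_mul_eq_one _ (Unitary.coe_mul_star_self hA.eigenvectorUnitary)
  rw [← Unitary.coe_star, hinv, Matrix.exp_conj _ _ hu, Matrix.exp_diagonal]
  congr 3
  ext i
  simp [Pi.coe_exp, Complex.exp_eq_exp_ℂ]

/-- The squared moduli of the inner products between the eigenvectors of `A` and those of `B`. -/
noncomputable def overlap (hA : A.IsHermitian) (hB : B.IsHermitian) (i j : ι) : ℝ :=
  Complex.normSq ((star (hA.eigenvectorUnitary : Matrix ι ι ℂ) *
    (hB.eigenvectorUnitary : Matrix ι ι ℂ)) i j)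

theorem overlap_nonneg (hA : A.IsHermitian) (hB : B.IsHermitian) (i j : ι) :
    0 ≤ overlap hA hB i j := Complex.normSq_nonneg _

/-- Under the trace only the unitary `W = U* V` between the two eigenbases survives. Its squared
moduli form nonnegative doubly stochastic weights, so scalar inequalities in two variables transfer
to traces of non-commuting `A` and `B`. -/
theorem trForm_cfc_cfc (hA : A.IsHermitian) (hB : B.IsHermitian) (f g : ℝ → ℝ) :
    trForm (hA.cfc f) (hB.cfc g) =
      ∑ i, ∑ j, overlap hA hB i j * (f (hA.eigenvalues i) * g (hB.eigenvalues j)) := by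
  let U : Matrix ι ι ℂ := hA.eigenvectorUnitary
  let V : Matrix ι ι ℂ := hB.eigenvectorUnitary
  set W := star U * V with hW
  have h : (hA.cfc f * hB.cfc g).trace =
      (Matrix.diagonal (RCLike.ofReal ∘ f ∘ hA.eigenvalues) * (W *
        Matrix.diagonal (RCLike.ofReal ∘ g ∘ hB.eigenvalues) * star W)).trace := by
    rw [Matrix.IsHermitian.cfc, Matrix.IsHermitian.cfc, Unitary.conjStarAlgAut_apply,
      Unitary.conjStarAlgAut_apply, hW, star_mul, star_star, Matrix.mul_assoc, Matrix.mul_assoc,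
      Matrix.trace_mul_comm]
    simp only [Matrix.mul_assoc]
    rfl
  rw [trForm_apply, h, Matrix.trace]
  simp only [Matrix.diag, Matrix.diagonal_mul, Complex.re_sum]
  refine Finset.sum_congr rfl fun i _ => ?_
  rw [Matrix.mul_apply, Finset.mul_sum, Complex.re_sum]
  refine Finset.sum_congr rfl fun j _ => ?_
  rw [Matrix.mul_diagonal, Matrix.star_apply, overlap]
  change _ = Complex.normSq (W i j) * _
  have : (W i j * ((g (hB.eigenvalues j) : ℝ) : ℂ) * star (W i j)) =
      ((Complex.normSq (W i j) * g (hB.eigenvalues j) : ℝ) : ℂ) := by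
    rw [mul_right_comm, Complex.star_def, Complex.mul_conj, Complex.ofReal_mul]
  simp only [Function.comp_apply, Complex.coe_algebraMap] at this ⊢
  erw [this]
  erw [← Complex.ofReal_mul]
  rw [Complex.ofReal_re]
  ring

theorem sum_overlap_left (hA : A.IsHermitian) (hB : B.IsHermitian) (j : ι) :
    ∑ i, overlap hA hB i j = 1 := by
  have h := congrFun₂ (show star (star (hA.eigenvectorUnitary : Matrix ι ι ℂ) *
    (hB.eigenvectorUnitary : Matrix ι ι ℂ)) * (star (hA.eigenvectorUnitary : Matrix ι ι ℂ) *
    (hB.eigenvectorUnitary : Matrix ι ι ℂ)) = 1 by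
      rw [star_mul, star_star, mul_assoc, ← mul_assoc (hA.eigenvectorUnitary : Matrix ι ι ℂ),
        hA.eigenvectorUnitary.2.2, one_mul, hB.eigenvectorUnitary.2.1]) j j
  rw [Matrix.mul_apply, Matrix.one_apply_eq] at h
  rw [← Complex.ofReal_inj, Complex.ofReal_sum, Complex.ofReal_one, ← h]
  refine Finset.sum_congr rfl fun i _ => ?_
  rw [Matrix.star_apply, overlap, Complex.normSq_eq_conj_mul_self, Complex.star_def]

theorem overlap_comm (hA : A.IsHermitian) (hB : B.IsHermitian) (i j : ι) :
    overlap hA hB i j = overlap hB hA j i := by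
  rw [overlap, overlap, ← Complex.normSq_conj, ← Complex.star_def, ← Matrix.star_apply, star_mul,
    star_star]

theorem sum_overlap_right (hA : A.IsHermitian) (hB : B.IsHermitian) (i : ι) :
    ∑ j, overlap hA hB i j = 1 := by
  simp_rw [overlap_comm hA hB]
  exact sum_overlap_left hB hA i

/-- The unrelated `B` enters through overlaps summing to one, so that this trace can be merged with
double sums over both spectra. -/
theorem trace_cfc_re (hA : A.IsHermitian) (hB : B.IsHermitian) (f : ℝ → ℝ) :
    (hA.cfc f).trace.re = ∑ i, ∑ j, overlap hA hB i j * f (hA.eigenvalues i) := by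
  rw [← mul_one (hA.cfc f), ← cfc_one_eq hB, ← trForm_apply, trForm_cfc_cfc]
  simp

theorem trace_cfc_re' (hA : A.IsHermitian) (f : ℝ → ℝ) :
    (hA.cfc f).trace.re = ∑ i, f (hA.eigenvalues i) := by
  rw [trace_cfc_re hA hA]
  simp_rw [← Finset.sum_mul, sum_overlap_right, one_mul]

theorem trForm_cfc_cfc_self (hA : A.IsHermitian) (f g : ℝ → ℝ) :
    trForm (hA.cfc f) (hA.cfc g) = ∑ i, f (hA.eigenvalues i) * g (hA.eigenvalues i) := by
  rw [← trace_cfc_re' hA (fun x => f x * g x), trForm_apply, Matrix.IsHermitian.cfc,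
    Matrix.IsHermitian.cfc, Matrix.IsHermitian.cfc, ← map_mul, Matrix.diagonal_mul_diagonal]
  congr 4
  ext i
  simp

theorem trForm_cfc_cfc_self_left (hA : A.IsHermitian) (hB : B.IsHermitian) (f g : ℝ → ℝ) :
    trForm (hA.cfc f) (hA.cfc g) =
      ∑ i, ∑ j, overlap hA hB i j * (f (hA.eigenvalues i) * g (hA.eigenvalues i)) := by
  simp_rw [trForm_cfc_cfc_self, ← Finset.sum_mul, sum_overlap_right, one_mul]

theorem trForm_cfc_sub_self (hA : A.IsHermitian) (hB : B.IsHermitian) (f g : ℝ → ℝ) :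
    trForm (hA.cfc f - hB.cfc g) (hA.cfc f - hB.cfc g) =
      ∑ i, ∑ j, overlap hA hB i j * (f (hA.eigenvalues i) - g (hB.eigenvalues j)) ^ 2 := by
  have h2 : trForm (hB.cfc g) (hB.cfc g) =
      ∑ i, ∑ j, overlap hA hB i j * (g (hB.eigenvalues j) * g (hB.eigenvalues j)) := by
    rw [trForm_cfc_cfc_self_left hB hA, Finset.sum_comm]
    simp_rw [overlap_comm hB hA]
  simp only [map_sub, LinearMap.sub_apply]
  rw [trForm_comm (hB.cfc g) (hA.cfc f), h2, trForm_cfc_cfc_self_left hA hB, trForm_cfc_cfc]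
  simp only [← Finset.sum_sub_distrib]
  refine Finset.sum_congr rfl fun i _ => Finset.sum_congr rfl fun j _ => ?_
  ring

end Spectral

/-! ### Smoothness and convexity of `tr exp`; Klein's inequality -/

section ExpBounds

variable {ι : Type*} [Fintype ι] [DecidableEq ι] {A B : Matrix ι ι ℂ}

theorem continuous_matrix_exp : Continuous (NormedSpace.exp : Matrix ι ι ℂ → Matrix ι ι ℂ) := by
  -- Continuity concerns only the topology; any submultiplicative norm inducing it serves.
  let _ : NormedRing (Matrix ι ι ℂ) := Matrix.linftyOpNormedRing
  let _ : NormedAlgebra ℂ (Matrix ι ι ℂ) := Matrix.linftyOpNormedAlgebra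
  let _ : NormedAlgebra ℚ (Matrix ι ι ℂ) := NormedAlgebra.restrictScalars ℚ ℂ _
  exact NormedSpace.exp_continuous

theorem sq_eigenvalues_le (hA : A.IsHermitian) (i : ι) :
    hA.eigenvalues i ^ 2 ≤ trForm A A := by
  have h := trForm_cfc_cfc_self hA id id
  rw [cfc_id_eq hA] at h
  rw [h]
  simp_rw [id, ← pow_two]
  exact Finset.single_le_sum (f := fun i => hA.eigenvalues i ^ 2) (fun i _ => sq_nonneg _)
    (Finset.mem_univ i)

theorem trForm_self_le_of_abs_eigenvalues_le (hA : A.IsHermitian) {M : ℝ}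
    (h : ∀ i, |hA.eigenvalues i| ≤ M) : trForm A A ≤ Fintype.card ι * M ^ 2 := by
  have e := trForm_cfc_cfc_self hA id id
  rw [cfc_id_eq hA] at e
  rw [e]
  refine (Finset.sum_le_card_nsmul _ _ (M ^ 2) fun i _ => ?_).trans (by simp)
  rw [id, ← pow_two, ← sq_abs]
  exact pow_le_pow_left₀ (abs_nonneg _) (h i) 2

/-- Only `tr (exp A · B)` involves both eigenbases; every other term is padded by the overlap
weights. The scalar second-order bounds then apply summand by summand. -/
theorem exp_bregman_eq (hA : A.IsHermitian) (hB : B.IsHermitian) :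
    (NormedSpace.exp B).trace.re - (NormedSpace.exp A).trace.re -
        trForm (NormedSpace.exp A) (B - A) =
      ∑ i, ∑ j, overlap hA hB i j * (Real.exp (hB.eigenvalues j) - Real.exp (hA.eigenvalues i) -
        Real.exp (hA.eigenvalues i) * (hB.eigenvalues j - hA.eigenvalues i)) := by
  have h1 := trForm_cfc_cfc hA hB Real.exp id
  have h2 := trForm_cfc_cfc_self_left hA hB Real.exp id
  have h3 := trace_cfc_re hA hB Real.exp
  have h4 := trace_cfc_re hB hA Real.exp
  rw [Finset.sum_comm] at h4
  simp_rw [overlap_comm hB hA] at h4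
  rw [cfc_exp_eq, cfc_id_eq] at h1 h2
  rw [cfc_exp_eq] at h3 h4
  rw [map_sub, h1, h2, h3, h4]
  simp only [← Finset.sum_sub_distrib]
  refine Finset.sum_congr rfl fun i _ => Finset.sum_congr rfl fun j _ => ?_
  simp only [id]
  ring

theorem trForm_sub_self_eq (hA : A.IsHermitian) (hB : B.IsHermitian) :
    trForm (B - A) (B - A) =
      ∑ i, ∑ j, overlap hA hB i j * (hB.eigenvalues j - hA.eigenvalues i) ^ 2 := by
  have h := trForm_cfc_sub_self hA hB id id
  rw [cfc_id_eq, cfc_id_eq, ← neg_sub B A] at h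
  simp only [map_neg, LinearMap.neg_apply, neg_neg] at h
  rw [h]
  refine Finset.sum_congr rfl fun i _ => Finset.sum_congr rfl fun j _ => ?_
  simp only [id]
  ring

theorem exp_bregman_matrix_le (hA : A.IsHermitian) (hB : B.IsHermitian) {M : ℝ}
    (ha : ∀ i, hA.eigenvalues i ≤ M) (hb : ∀ i, hB.eigenvalues i ≤ M) :
    (NormedSpace.exp B).trace.re - (NormedSpace.exp A).trace.re -
      trForm (NormedSpace.exp A) (B - A) ≤ Real.exp M / 2 * trForm (B - A) (B - A) := by
  rw [exp_bregman_eq hA hB, trForm_sub_self_eq hA hB, Finset.mul_sum]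
  refine Finset.sum_le_sum fun i _ => ?_
  rw [Finset.mul_sum]
  refine Finset.sum_le_sum fun j _ => ?_
  rw [mul_left_comm]
  exact mul_le_mul_of_nonneg_left (exp_bregman_le (ha i) (hb j)) (overlap_nonneg _ _ _ _)

theorem le_exp_bregman_matrix (hA : A.IsHermitian) (hB : B.IsHermitian) {M : ℝ}
    (ha : ∀ i, M ≤ hA.eigenvalues i) (hb : ∀ i, M ≤ hB.eigenvalues i) :
    Real.exp M / 2 * trForm (B - A) (B - A) ≤ (NormedSpace.exp B).trace.re -
      (NormedSpace.exp A).trace.re - trForm (NormedSpace.exp A) (B - A) := by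
  rw [exp_bregman_eq hA hB, trForm_sub_self_eq hA hB, Finset.mul_sum]
  refine Finset.sum_le_sum fun i _ => ?_
  rw [Finset.mul_sum]
  refine Finset.sum_le_sum fun j _ => ?_
  rw [mul_left_comm]
  exact mul_le_mul_of_nonneg_left (le_exp_bregman (ha i) (hb j)) (overlap_nonneg _ _ _ _)

theorem trForm_exp_sub_exp_le (hA : A.IsHermitian) (hB : B.IsHermitian) {M : ℝ}
    (ha : ∀ i, hA.eigenvalues i ≤ M) (hb : ∀ i, hB.eigenvalues i ≤ M) :
    trForm (NormedSpace.exp A - NormedSpace.exp B) (NormedSpace.exp A - NormedSpace.exp B) ≤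
      Real.exp M ^ 2 * trForm (A - B) (A - B) := by
  have h := trForm_cfc_sub_self hA hB Real.exp Real.exp
  have h' := trForm_cfc_sub_self hA hB id id
  rw [cfc_exp_eq, cfc_exp_eq] at h
  rw [cfc_id_eq, cfc_id_eq] at h'
  rw [h, h', Finset.mul_sum]
  refine Finset.sum_le_sum fun i _ => ?_
  rw [Finset.mul_sum]
  refine Finset.sum_le_sum fun j _ => ?_
  rw [mul_left_comm]
  exact mul_le_mul_of_nonneg_left (sq_exp_sub_exp_le (ha i) (hb j)) (overlap_nonneg _ _ _ _)

theorem klein_eq {Γ : Matrix ι ι ℂ} (hΓ : Γ.IsHermitian) (hA : A.IsHermitian) :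
    negEntropy Γ - trForm Γ A + (NormedSpace.exp A).trace.re - Γ.trace.re =
      ∑ i, ∑ j, overlap hΓ hA i j * (hΓ.eigenvalues i * Real.log (hΓ.eigenvalues i) -
        hΓ.eigenvalues i * hA.eigenvalues j + Real.exp (hA.eigenvalues j) - hΓ.eigenvalues i) := by
  have h1 := trForm_cfc_cfc_self_left hΓ hA id Real.log
  have h2 := trForm_cfc_cfc hΓ hA id id
  have h3 := trace_cfc_re hA hΓ Real.exp
  have h4 := trace_cfc_re hΓ hA id
  rw [Finset.sum_comm] at h3
  simp_rw [overlap_comm hA hΓ] at h3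
  rw [cfc_exp_eq] at h3
  rw [cfc_id_eq] at h1 h4
  rw [cfc_id_eq, cfc_id_eq] at h2
  rw [← hΓ.cfc_eq] at h1
  rw [negEntropy, ← trForm_apply, h1, h2, h3, h4]
  simp only [← Finset.sum_sub_distrib, ← Finset.sum_add_distrib]
  refine Finset.sum_congr rfl fun i _ => Finset.sum_congr rfl fun j _ => ?_
  simp only [id]
  ring

/-- Klein's inequality. -/
theorem klein_nonneg {Γ : Matrix ι ι ℂ} (hΓ : Γ.PosSemidef) (hA : A.IsHermitian) :
    0 ≤ negEntropy Γ - trForm Γ A + (NormedSpace.exp A).trace.re - Γ.trace.re := by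
  rw [klein_eq hΓ.isHermitian hA]
  exact Finset.sum_nonneg fun i _ => Finset.sum_nonneg fun j _ =>
    mul_nonneg (overlap_nonneg _ _ _ _) (klein_scalar_nonneg (hΓ.eigenvalues_nonneg i) _)

/-- The equality case of Klein's inequality. -/
theorem eq_exp_of_klein_le {Γ : Matrix ι ι ℂ} (hΓ : Γ.PosSemidef) (hA : A.IsHermitian)
    (h : negEntropy Γ - trForm Γ A + (NormedSpace.exp A).trace.re - Γ.trace.re ≤ 0) :
    Γ = NormedSpace.exp A := by
  have hterm : ∀ i j, 0 ≤ overlap hΓ.isHermitian hA i j * (hΓ.isHermitian.eigenvalues i *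
      Real.log (hΓ.isHermitian.eigenvalues i) - hΓ.isHermitian.eigenvalues i * hA.eigenvalues j +
      Real.exp (hA.eigenvalues j) - hΓ.isHermitian.eigenvalues i) := fun i j =>
    mul_nonneg (overlap_nonneg _ _ _ _) (klein_scalar_nonneg (hΓ.eigenvalues_nonneg i) _)
  have h0 := h.antisymm (klein_nonneg hΓ hA)
  rw [klein_eq hΓ.isHermitian hA,
    Finset.sum_eq_zero_iff_of_nonneg fun i _ => Finset.sum_nonneg fun j _ => hterm i j] at h0
  -- Each Klein summand vanishes, so wherever the overlap is nonzero the eigenvalue of `Γ` equals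
  -- the exponential of that of `A`. This makes the squared distance between `Γ` and `exp A` vanish.
  have hd := trForm_cfc_sub_self hΓ.isHermitian hA id Real.exp
  rw [cfc_id_eq, cfc_exp_eq] at hd
  refine sub_eq_zero.1 (eq_zero_of_trForm_self_le (hΓ.isHermitian.sub hA.exp) (hd.trans ?_).le)
  refine Finset.sum_eq_zero fun i _ => Finset.sum_eq_zero fun j _ => ?_
  have h1 := (Finset.sum_eq_zero_iff_of_nonneg fun j _ => hterm i j).1 (h0 i (Finset.mem_univ i)) j
    (Finset.mem_univ j)
  rcases mul_eq_zero.1 h1 with h2 | h2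
  · rw [h2, zero_mul]
  · rw [id, eq_exp_of_klein_scalar_eq_zero (hΓ.eigenvalues_nonneg i) h2]
    simp

end ExpBounds

/-! ### The normalised dual gap: sublevel sets and descent -/

section DualGap

variable {ι : Type*} [Fintype ι] [DecidableEq ι] {ω A B : Matrix ι ι ℂ}

/-- The normalised gap `tr (exp A) - tr (ω A) - 1` between the primal value of the reference state
`ω` and the dual value at `A`. -/
noncomputable def dualGap (ω A : Matrix ι ι ℂ) : ℝ :=
  (NormedSpace.exp A).trace.re - trForm ω A - 1

theorem continuous_dualGap (ω : Matrix ι ι ℂ) : Continuous (dualGap ω) := by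
  have h := continuous_matrix_exp (ι := ι)
  unfold dualGap
  simp only [trForm_apply]
  fun_prop

/-- The diagonal of `ω` in the eigenbasis of `A`. -/
noncomputable def eigenMass (hω : ω.IsHermitian) (hA : A.IsHermitian) (j : ι) : ℝ :=
  ∑ i, overlap hω hA i j * hω.eigenvalues i

theorem le_eigenMass (hω : ω.IsHermitian) (hA : A.IsHermitian) {c : ℝ}
    (h : ∀ i, c ≤ hω.eigenvalues i) (j : ι) : c ≤ eigenMass hω hA j := by
  calc c = ∑ i, overlap hω hA i j * c := by rw [← Finset.sum_mul, sum_overlap_left, one_mul]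
    _ ≤ _ := Finset.sum_le_sum fun i _ =>
      mul_le_mul_of_nonneg_left (h i) (overlap_nonneg _ _ _ _)

theorem sum_eigenMass (hω : IsState ω) (hA : A.IsHermitian) :
    ∑ j, eigenMass hω.1.isHermitian hA j = 1 := by
  have h := trace_cfc_re hω.1.isHermitian hA id
  have h2 := congrArg Complex.re hω.2
  rw [Complex.one_re] at h2
  rw [cfc_id_eq, Finset.sum_comm] at h
  exact h.symm.trans h2

theorem eigenMass_le_one (hω : IsState ω) (hA : A.IsHermitian) (j : ι) :
    eigenMass hω.1.isHermitian hA j ≤ 1 := by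
  rw [← sum_eigenMass hω hA]
  exact Finset.single_le_sum (f := eigenMass hω.1.isHermitian hA)
    (fun j _ => le_eigenMass _ _ hω.1.eigenvalues_nonneg j) (Finset.mem_univ j)

/-- The constant `1` is distributed over the eigenvalues as the sum of the masses, which makes every
summand separately nonnegative. -/
theorem dualGap_eq (hω : IsState ω) (hA : A.IsHermitian) :
    dualGap ω A = ∑ j, (Real.exp (hA.eigenvalues j) -
      eigenMass hω.1.isHermitian hA j * (hA.eigenvalues j + 1)) := by
  have h1 := trace_cfc_re' hA Real.exp
  have h2 := trForm_cfc_cfc hω.1.isHermitian hA id id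
  have h3 := sum_eigenMass hω hA
  rw [cfc_exp_eq] at h1
  rw [cfc_id_eq, cfc_id_eq, Finset.sum_comm] at h2
  simp only [mul_add, mul_one, Finset.sum_sub_distrib, Finset.sum_add_distrib, h3]
  rw [dualGap, h1, h2, sub_sub]
  simp only [eigenMass, Finset.sum_mul, id, mul_assoc]

theorem dualGap_term_nonneg (hω : IsState ω) (hA : A.IsHermitian) (j : ι) :
    0 ≤ Real.exp (hA.eigenvalues j) -
      eigenMass hω.1.isHermitian hA j * (hA.eigenvalues j + 1) := by
  have h0 := le_eigenMass hω.1.isHermitian hA hω.1.eigenvalues_nonneg j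
  have h1 := eigenMass_le_one hω hA j
  have h2 := Real.add_one_le_exp (hA.eigenvalues j)
  have h3 := Real.exp_pos (hA.eigenvalues j)
  rcases le_total 0 (hA.eigenvalues j + 1) with h | h <;> nlinarith

theorem dualGap_nonneg (hω : IsState ω) (hA : A.IsHermitian) : 0 ≤ dualGap ω A := by
  rw [dualGap_eq hω hA]
  exact Finset.sum_nonneg fun j _ => dualGap_term_nonneg hω hA j

theorem dualGap_term_le (hω : IsState ω) (hA : A.IsHermitian) (j : ι) :
    Real.exp (hA.eigenvalues j) -
      eigenMass hω.1.isHermitian hA j * (hA.eigenvalues j + 1) ≤ dualGap ω A := by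
  rw [dualGap_eq hω hA]
  exact Finset.single_le_sum (f := fun j => Real.exp (hA.eigenvalues j) -
      eigenMass hω.1.isHermitian hA j * (hA.eigenvalues j + 1))
    (fun j _ => dualGap_term_nonneg hω hA j) (Finset.mem_univ j)

theorem eigenvalues_le_nu₂ (hω : IsState ω) (hA : A.IsHermitian) {Q : ℝ} (hQ : dualGap ω A ≤ Q)
    (j : ι) : hA.eigenvalues j ≤ nu₂ Q := by
  refine le_nu₂ ((dualGap_nonneg hω hA).trans hQ) fun h => ?_
  have h1 := dualGap_term_le hω hA j
  have h2 := eigenMass_le_one hω hA j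
  nlinarith

/-- Dropping the exponential from a single summand leaves `-p_j (λ_j + 1) ≤ Q`, and `p_j ≥ c`. -/
theorem le_eigenvalues (hω : IsState ω) (hA : A.IsHermitian) {Q c : ℝ} (hc : 0 < c)
    (hωc : ∀ i, c ≤ hω.1.isHermitian.eigenvalues i) (hQ : dualGap ω A ≤ Q) (j : ι) :
    -(Q / c) - 1 ≤ hA.eigenvalues j := by
  have h1 := (dualGap_term_le hω hA j).trans hQ
  have h2 := le_eigenMass hω.1.isHermitian hA hωc j
  have h3 := Real.exp_pos (hA.eigenvalues j)
  have h4 : 0 ≤ Q := (dualGap_nonneg hω hA).trans hQ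
  by_contra! h
  have h5 : Q / c < -(hA.eigenvalues j + 1) := by linarith
  rw [div_lt_iff₀ hc] at h5
  have h6 : 0 ≤ -(hA.eigenvalues j + 1) := by
    have := div_nonneg h4 hc.le
    linarith
  nlinarith [mul_le_mul_of_nonneg_left h2 h6]

theorem exists_pos_le_eigenvalues (hω : ω.PosDef) :
    ∃ c : ℝ, 0 < c ∧ ∀ i, c ≤ hω.isHermitian.eigenvalues i := by
  cases isEmpty_or_nonempty ι
  · exact ⟨1, one_pos, fun i => isEmptyElim i⟩
  · obtain ⟨i, hi⟩ := Finite.exists_min hω.isHermitian.eigenvalues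
    exact ⟨_, hω.eigenvalues_pos i, hi⟩

theorem dualGap_le (hA : A.IsHermitian) (hB : B.IsHermitian) {M : ℝ}
    (ha : ∀ i, hA.eigenvalues i ≤ M) (hb : ∀ i, hB.eigenvalues i ≤ M) :
    dualGap ω B ≤ dualGap ω A - trForm (ω - NormedSpace.exp A) (B - A) +
      Real.exp M / 2 * trForm (B - A) (B - A) := by
  have h := exp_bregman_matrix_le hA hB ha hb
  have h2 : trForm ω (B - A) = trForm ω B - trForm ω A := map_sub _ _ _
  rw [dualGap, dualGap, LinearMap.map_sub₂]
  linarith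

theorem le_dualGap (hA : A.IsHermitian) (hB : B.IsHermitian) {M : ℝ}
    (ha : ∀ i, M ≤ hA.eigenvalues i) (hb : ∀ i, M ≤ hB.eigenvalues i) :
    dualGap ω A - trForm (ω - NormedSpace.exp A) (B - A) +
      Real.exp M / 2 * trForm (B - A) (B - A) ≤ dualGap ω B := by
  have h := le_exp_bregman_matrix hA hB ha hb
  have h2 : trForm ω (B - A) = trForm ω B - trForm ω A := map_sub _ _ _
  rw [dualGap, dualGap, LinearMap.map_sub₂]
  linarith

omit [Fintype ι] [DecidableEq ι] in
theorem isHermitian_add_smul (hA : A.IsHermitian) (hB : B.IsHermitian) (t : ℝ) :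
    (A + t • B).IsHermitian := hA.add (hB.smul (IsSelfAdjoint.all t))

theorem dualGap_add_smul_le {X : Matrix ι ι ℂ} (hA : A.IsHermitian) (hX : X.IsHermitian) {M t : ℝ}
    (ha : ∀ i, hA.eigenvalues i ≤ M) (hb : ∀ i, (isHermitian_add_smul hA hX t).eigenvalues i ≤ M) :
    dualGap ω (A + t • X) ≤ dualGap ω A - t * trForm (ω - NormedSpace.exp A) X +
      Real.exp M / 2 * (t ^ 2 * trForm X X) := by
  have h := dualGap_le (ω := ω) hA (isHermitian_add_smul hA hX t) ha hb
  rw [add_sub_cancel_left] at h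
  simp only [map_smul, LinearMap.smul_apply, smul_eq_mul] at h
  linarith

/-- Descent of the gap under a gradient step whose step size is adapted to the sublevel set of the
starting point: the step does not leave the sublevel set, on which the gap is smooth. -/
theorem dualGap_step_le {X : Matrix ι ι ℂ} (hA : A.IsHermitian) (hX : X.IsHermitian) {d β γ : ℝ}
    (hd : 0 < d)
    (hβ : ∀ (B : Matrix ι ι ℂ) (hB : B.IsHermitian), dualGap ω B ≤ dualGap ω A →
      ∀ i, hB.eigenvalues i ≤ β)
    (hγ : trForm (ω - NormedSpace.exp A) X = γ) (hN : trForm X X = d * γ) :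
    dualGap ω (A + (Real.exp (-β) / d) • X) ≤ dualGap ω A - Real.exp (-β) / d * γ / 2 := by
  set s := Real.exp (-β) / d with hs
  have hs0 : 0 < s := div_pos (Real.exp_pos _) hd
  have hsd : Real.exp β * d * s = 1 := by
    rw [hs, Real.exp_neg]
    field_simp
  have hγ0 : 0 ≤ γ := by
    have := trForm_self_nonneg hX
    rw [hN] at this
    exact nonneg_of_mul_nonneg_right this hd
  -- The smoothness constant `exp β` is available only between points of the sublevel set, hence the
  -- premise on the endpoint.
  have key : ∀ t, dualGap ω (A + t • X) ≤ dualGap ω A →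
      dualGap ω (A + t • X) ≤ dualGap ω A - t * γ + (Real.exp β * d) * t ^ 2 * γ / 2 := by
    intro t ht
    have h := dualGap_add_smul_le (ω := ω) hA hX (t := t) (hβ A hA le_rfl) (hβ _ _ ht)
    rw [hγ, hN] at h
    linarith
  suffices h : dualGap ω (A + s • X) ≤ dualGap ω A by
    have h1 := key s h
    have h2 : Real.exp β * d * s ^ 2 * γ / 2 = (Real.exp β * d * s) * (s * γ / 2) := by ring
    rw [h2, hsd] at h1
    linarith
  rcases hγ0.eq_or_lt with rfl | hγ0
  · rw [eq_zero_of_trForm_self_le hX (by rw [hN, mul_zero])]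
    simp
  by_contra! hlt
  -- A crude eigenvalue bound on the whole segment, from `‖A + tX‖² ≤ 2‖A‖² + 2t²‖X‖²` and `2λ ≤ λ²
  -- + 1`. It serves only to show that some short initial step stays in the sublevel set.
  set R := 2 * trForm A A + 2 * s ^ 2 * trForm X X + 1
  have hR : ∀ t, 0 ≤ t → t ≤ s → ∀ i, (isHermitian_add_smul hA hX t).eigenvalues i ≤ R := by
    intro t ht0 hts i
    have h1 := sq_eigenvalues_le (isHermitian_add_smul hA hX t) i
    have h2 := trForm_self_nonneg (isHermitian_add_smul hA hX (-t))
    simp only [map_add, LinearMap.add_apply, map_smul, LinearMap.smul_apply, smul_eq_mul,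
      trForm_comm X A] at h1 h2
    have h3 := trForm_self_nonneg hX
    have h4 : t ^ 2 ≤ s ^ 2 := pow_le_pow_left₀ ht0 hts 2
    nlinarith [sq_nonneg ((isHermitian_add_smul hA hX t).eigenvalues i - 1)]
  have hR0 : ∀ i, hA.eigenvalues i ≤ R := by
    intro i
    have h1 := sq_eigenvalues_le hA i
    have h2 := trForm_self_nonneg hA
    have h3 := trForm_self_nonneg hX
    nlinarith [sq_nonneg (hA.eigenvalues i - 1), mul_nonneg (sq_nonneg s) h3]
  obtain ⟨t₀, ht0, hts, htR⟩ : ∃ t₀ : ℝ, 0 < t₀ ∧ t₀ ≤ s ∧ Real.exp R * d * t₀ ≤ 1 := by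
    have hp : 0 < Real.exp R * d := mul_pos (Real.exp_pos _) hd
    refine ⟨min s (Real.exp R * d)⁻¹, lt_min hs0 (inv_pos.2 hp), min_le_left _ _, ?_⟩
    calc _ ≤ Real.exp R * d * (Real.exp R * d)⁻¹ :=
          mul_le_mul_of_nonneg_left (min_le_right _ _) hp.le
      _ = 1 := mul_inv_cancel₀ hp.ne'
  have h0 : dualGap ω (A + t₀ • X) ≤ dualGap ω A := by
    have h := dualGap_add_smul_le (ω := ω) hA hX (t := t₀) hR0 (hR t₀ ht0.le hts)
    rw [hγ, hN] at h
    have h2 := mul_pos ht0 hγ0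
    nlinarith [mul_le_mul_of_nonneg_right htR h2.le]
  have hcont : Continuous fun t : ℝ => dualGap ω (A + t • X) :=
    (continuous_dualGap ω).comp (by fun_prop)
  -- If the full step left the sublevel set, the gap would return to its starting value at some `t`
  -- in `[t₀, s]`. There `key` applies and, since `exp β · d · t ≤ 1`, forces a strict decrease.
  obtain ⟨t, ht, hteq⟩ := intermediate_value_Icc hts hcont.continuousOn ⟨h0, hlt.le⟩
  simp only at hteq
  have h1 := key t hteq.le
  have ht' : 0 < t := ht0.trans_le ht.1
  have h2 : Real.exp β * d * t ≤ 1 := by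
    rw [← hsd]
    exact mul_le_mul_of_nonneg_left ht.2 (mul_pos (Real.exp_pos _) hd).le
  have h3 := mul_pos ht' hγ0
  nlinarith [mul_le_mul_of_nonneg_right h2 h3.le]

theorem abs_eigenvalues_le (hω : IsState ω) (hA : A.IsHermitian) {Q c : ℝ} (hc : 0 < c)
    (hωc : ∀ i, c ≤ hω.1.isHermitian.eigenvalues i) (hQ : dualGap ω A ≤ Q) (j : ι) :
    |hA.eigenvalues j| ≤ max (nu₂ Q) (Q / c + 1) :=
  abs_le'.2 ⟨(eigenvalues_le_nu₂ hω hA hQ j).trans (le_max_left _ _),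
    le_max_of_le_right (by linarith [le_eigenvalues hω hA hc hωc hQ j])⟩

/-- The two-sided eigenvalue bound controls the Hilbert-Schmidt norm, hence every entry, so the set
is a closed subset of a product of discs. -/
theorem isCompact_sublevel_dualGap (hω : IsState ω) (hωpos : ω.PosDef) {T : Set (Matrix ι ι ℂ)}
    (hT : IsClosed T) (hTH : ∀ A ∈ T, A.IsHermitian) (Q : ℝ) :
    IsCompact {A | A ∈ T ∧ dualGap ω A ≤ Q} := by
  obtain ⟨c, hc, hωc⟩ := exists_pos_le_eigenvalues hωpos
  set R := Fintype.card ι * max (nu₂ Q) (Q / c + 1) ^ 2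
  have hbox : IsCompact (Set.univ.pi fun _ => Set.univ.pi fun _ =>
      Metric.closedBall (0 : ℂ) (Real.sqrt R) : Set (ι → ι → ℂ)) :=
    isCompact_univ_pi fun _ => isCompact_univ_pi fun _ => isCompact_closedBall _ _
  refine hbox.of_isClosed_subset
    (hT.inter (isClosed_le (continuous_dualGap ω) continuous_const)) fun A hA => ?_
  have hAH := hTH A hA.1
  intro i _ j _
  rw [mem_closedBall_zero_iff]
  refine Real.le_sqrt_of_sq_le ?_
  rw [← Complex.normSq_eq_norm_sq]
  exact (normSq_apply_le_trForm_self hAH i j).trans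
    (trForm_self_le_of_abs_eigenvalues_le hAH (abs_eigenvalues_le hω hAH hc hωc hA.2))

omit [DecidableEq ι] in
-- Expand `‖X - cY‖² ≥ 0`.
theorem trForm_sub_self_le {X Y : Matrix ι ι ℂ} (hX : X.IsHermitian) (hY : Y.IsHermitian)
    {c : ℝ} (hc : 0 < c) : trForm X Y - c / 2 * trForm Y Y ≤ trForm X X / (2 * c) := by
  have h := trForm_self_nonneg (isHermitian_add_smul hX hY (-c))
  simp only [map_add, LinearMap.add_apply, map_smul, LinearMap.smul_apply, smul_eq_mul,
    trForm_comm Y X] at h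
  rw [le_div_iff₀ (by linarith)]
  linarith

theorem negEntropy_exp (hA : A.IsHermitian) :
    negEntropy (NormedSpace.exp A) = trForm (NormedSpace.exp A) A := by
  have h : cfc Real.log (NormedSpace.exp A) = A := by
    rw [← cfc_exp_eq hA, ← hA.cfc_eq, ← cfc_comp Real.log Real.exp A hA.isSelfAdjoint
      (Real.continuousOn_log.mono (by rintro _ ⟨x, -, rfl⟩; exact (Real.exp_pos x).ne'))
      Real.continuous_exp.continuousOn]
    conv_rhs => rw [← cfc_id ℝ A hA.isSelfAdjoint]
    congr 1
    ext x
    exact Real.log_exp x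
  rw [negEntropy, h, trForm_apply]

theorem posSemidef_exp (hA : A.IsHermitian) : (NormedSpace.exp A).PosSemidef := by
  have h : NormedSpace.exp ((2⁻¹ : ℝ) • A) * NormedSpace.exp ((2⁻¹ : ℝ) • A) =
      NormedSpace.exp A := by
    rw [← Matrix.exp_add_of_commute _ _ (Commute.refl _), ← add_smul]
    norm_num
  have h2 : ((2⁻¹ : ℝ) • A).IsHermitian := hA.smul (IsSelfAdjoint.all _)
  have := Matrix.posSemidef_conjTranspose_mul_self (NormedSpace.exp ((2⁻¹ : ℝ) • A))
  rwa [h2.exp.eq, h] at this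

end DualGap

/-! ### Tensor sums and partial traces -/

section Tensor

set_option linter.unusedSectionVars false

variable {m n : Type*} [Fintype m] [DecidableEq m] [Fintype n] [DecidableEq n]

theorem tensorSum_add (U U' : Matrix m m ℂ) (V V' : Matrix n n ℂ) :
    tensorSum (U + U') (V + V') = tensorSum U V + tensorSum U' V' := by
  rw [tensorSum, tensorSum, tensorSum, Matrix.add_kronecker, Matrix.kronecker_add]
  abel

theorem tensorSum_smul (c : ℝ) (U : Matrix m m ℂ) (V : Matrix n n ℂ) :
    tensorSum (c • U) (c • V) = c • tensorSum U V := by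
  rw [tensorSum, tensorSum, Matrix.smul_kronecker, Matrix.kronecker_smul, smul_add]

theorem tensorSum_sub (U U' : Matrix m m ℂ) (V V' : Matrix n n ℂ) :
    tensorSum (U - U') (V - V') = tensorSum U V - tensorSum U' V' := by
  rw [eq_sub_iff_add_eq, ← tensorSum_add, sub_add_cancel, sub_add_cancel]

theorem isHermitian_tensorSum {U : Matrix m m ℂ} {V : Matrix n n ℂ} (hU : U.IsHermitian)
    (hV : V.IsHermitian) : (tensorSum U V).IsHermitian := by
  rw [tensorSum]
  refine Matrix.IsHermitian.add ?_ ?_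
  · rw [Matrix.IsHermitian, Matrix.conjTranspose_kronecker, hU.eq, Matrix.conjTranspose_one]
  · rw [Matrix.IsHermitian, Matrix.conjTranspose_kronecker, hV.eq, Matrix.conjTranspose_one]

/-- The tensor sum does not see a multiple of the identity moved from one factor to the other. -/
theorem tensorSum_add_sub_smul_one (U : Matrix m m ℂ) (V : Matrix n n ℂ) (c : ℝ) :
    tensorSum (U + c • 1) (V - c • 1) = tensorSum U V := by
  rw [tensorSum, tensorSum, sub_eq_add_neg V, ← neg_smul, Matrix.add_kronecker,
    Matrix.kronecker_add, Matrix.smul_kronecker, Matrix.kronecker_smul, neg_smul]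
  abel

theorem isHermitian_partialTrace₂ {Γ : Matrix (m × n) (m × n) ℂ} (h : Γ.IsHermitian) :
    (partialTrace₂ Γ).IsHermitian := by
  ext i j
  simp [partialTrace₂, Matrix.conjTranspose_apply, h.apply]

theorem isHermitian_partialTrace₁ {Γ : Matrix (m × n) (m × n) ℂ} (h : Γ.IsHermitian) :
    (partialTrace₁ Γ).IsHermitian := by
  ext i j
  simp [partialTrace₁, Matrix.conjTranspose_apply, h.apply]

theorem partialTrace₂_sub (Γ Δ : Matrix (m × n) (m × n) ℂ) :
    partialTrace₂ (Γ - Δ) = partialTrace₂ Γ - partialTrace₂ Δ := by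
  ext i j
  simp [partialTrace₂]

theorem partialTrace₁_sub (Γ Δ : Matrix (m × n) (m × n) ℂ) :
    partialTrace₁ (Γ - Δ) = partialTrace₁ Γ - partialTrace₁ Δ := by
  ext i j
  simp [partialTrace₁]

theorem partialTrace₂_kronecker (ρ : Matrix m m ℂ) {σ : Matrix n n ℂ} (hσ : σ.trace = 1) :
    partialTrace₂ (ρ ⊗ₖ σ) = ρ := by
  ext i j
  simp only [partialTrace₂, Matrix.of_apply, Matrix.kroneckerMap_apply, ← Finset.mul_sum]
  change ρ i j * σ.trace = _
  rw [hσ, mul_one]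

theorem partialTrace₁_kronecker {ρ : Matrix m m ℂ} (σ : Matrix n n ℂ) (hρ : ρ.trace = 1) :
    partialTrace₁ (ρ ⊗ₖ σ) = σ := by
  ext i j
  simp only [partialTrace₁, Matrix.of_apply, Matrix.kroneckerMap_apply, ← Finset.sum_mul]
  change ρ.trace * σ i j = _
  rw [hρ, one_mul]

theorem trace_partialTrace₂ (Γ : Matrix (m × n) (m × n) ℂ) :
    (partialTrace₂ Γ).trace = Γ.trace := by
  simp [partialTrace₂, Matrix.trace, Fintype.sum_prod_type]

theorem trForm_tensorSum (Γ : Matrix (m × n) (m × n) ℂ) (U : Matrix m m ℂ) (V : Matrix n n ℂ) :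
    trForm Γ (tensorSum U V) = trForm (partialTrace₂ Γ) U + trForm (partialTrace₁ Γ) V := by
  rw [tensorSum, map_add, trForm_apply, trForm_apply, trForm_apply, trForm_apply,
    trace_partialTrace₂_mul, trace_partialTrace₁_mul]

theorem partialTrace₂_tensorSum (U : Matrix m m ℂ) (V : Matrix n n ℂ) :
    partialTrace₂ (tensorSum U V) = (Fintype.card n : ℝ) • U + V.trace • 1 := by
  ext i j
  simp [partialTrace₂, tensorSum, Matrix.trace, Finset.sum_add_distrib, Finset.mul_sum, mul_comm]

theorem partialTrace₁_tensorSum (U : Matrix m m ℂ) (V : Matrix n n ℂ) :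
    partialTrace₁ (tensorSum U V) = U.trace • 1 + (Fintype.card m : ℝ) • V := by
  ext i j
  simp [partialTrace₁, tensorSum, Matrix.trace, Finset.sum_add_distrib, Finset.sum_mul]

/-- The cross terms are multiples of the trace of `V`. The factors `card n` and `card m` are what
the step sizes divide by. -/
theorem trForm_tensorSum_self (U : Matrix m m ℂ) {V : Matrix n n ℂ} (hV : V.trace = 0) :
    trForm (tensorSum U V) (tensorSum U V) =
      Fintype.card n * trForm U U + Fintype.card m * trForm V V := by
  rw [trForm_tensorSum, partialTrace₂_tensorSum, partialTrace₁_tensorSum, hV]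
  simp only [zero_smul, add_zero, map_add, LinearMap.add_apply, map_smul, LinearMap.smul_apply,
    smul_eq_mul]
  rw [trForm_apply (_ • _) V]
  simp [hV]

theorem trForm_tensorSum_zero_left_self (V : Matrix n n ℂ) :
    trForm (tensorSum (0 : Matrix m m ℂ) V) (tensorSum 0 V) = Fintype.card m * trForm V V := by
  rw [trForm_tensorSum, partialTrace₁_tensorSum]
  simp

/-- With `B = tr₁ Γ` and `d = card m`, expand `‖0 ⊕ B - dΓ‖² ≥ 0`, using that `Γ` pairs with `0 ⊕ B`
to `‖B‖²`. -/
theorem trForm_partialTrace₁_self_le [Nonempty m] {Γ : Matrix (m × n) (m × n) ℂ}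
    (h : Γ.IsHermitian) :
    trForm (partialTrace₁ Γ) (partialTrace₁ Γ) ≤ Fintype.card m * trForm Γ Γ := by
  have hd : (0 : ℝ) < Fintype.card m := Nat.cast_pos.2 Fintype.card_pos
  have hB := isHermitian_partialTrace₁ h
  have h1 := trForm_self_nonneg (isHermitian_add_smul
    (isHermitian_tensorSum (Matrix.isHermitian_zero (n := m)) hB) h (-(Fintype.card m : ℝ)))
  simp only [map_add, LinearMap.add_apply, map_smul, LinearMap.smul_apply, smul_eq_mul,
    trForm_comm _ Γ, trForm_tensorSum_zero_left_self] at h1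
  rw [trForm_tensorSum, map_zero, zero_add] at h1
  by_contra! hlt
  nlinarith [mul_lt_mul_of_pos_left hlt hd]

/-- Every tensor sum of Hermitian matrices can be written with a traceless second summand. -/
theorem exists_tensorSum_eq_trace_zero [Nonempty n] {U : Matrix m m ℂ} {V : Matrix n n ℂ}
    (hU : U.IsHermitian) (hV : V.IsHermitian) :
    ∃ (U' : Matrix m m ℂ) (V' : Matrix n n ℂ), U'.IsHermitian ∧ V'.IsHermitian ∧ V'.trace = 0 ∧
      tensorSum U' V' = tensorSum U V := by
  refine ⟨U + (V.trace.re / Fintype.card n) • 1, V - (V.trace.re / Fintype.card n) • 1,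
    hU.add (Matrix.isHermitian_one.smul (IsSelfAdjoint.all _)),
    hV.sub (Matrix.isHermitian_one.smul (IsSelfAdjoint.all _)), ?_,
    tensorSum_add_sub_smul_one _ _ _⟩
  have him : V.trace.im = 0 := by
    have h := congrArg Matrix.trace hV.eq
    rw [Matrix.trace_conjTranspose] at h
    exact Complex.conj_eq_iff_im.1 h
  apply Complex.ext
  · simp
  · simp [him]

/-- The real vector space of tensor sums of Hermitian matrices. -/
noncomputable def tensorSumSubmodule (m n : Type*) [Fintype m] [DecidableEq m] [Fintype n]
    [DecidableEq n] : Submodule ℝ (Matrix (m × n) (m × n) ℂ) where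
  carrier := {S | ∃ (U : Matrix m m ℂ) (V : Matrix n n ℂ), U.IsHermitian ∧ V.IsHermitian ∧
    tensorSum U V = S}
  add_mem' := by
    rintro _ _ ⟨U, V, hU, hV, rfl⟩ ⟨U', V', hU', hV', rfl⟩
    exact ⟨_, _, hU.add hU', hV.add hV', tensorSum_add _ _ _ _⟩
  zero_mem' := ⟨0, 0, Matrix.isHermitian_zero, Matrix.isHermitian_zero, by simp [tensorSum]⟩
  smul_mem' := by
    rintro c _ ⟨U, V, hU, hV, rfl⟩
    exact ⟨_, _, hU.smul (IsSelfAdjoint.all c), hV.smul (IsSelfAdjoint.all c),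
      tensorSum_smul _ _ _⟩

theorem isClosed_tensorSumSubmodule :
    IsClosed (tensorSumSubmodule m n : Set (Matrix (m × n) (m × n) ℂ)) :=
  Submodule.closed_of_finiteDimensional _

end Tensor

/-! ### From geometric bounds to limits -/

theorem liminf_neg_log_pos {h : ℕ → ℝ} {K q : ℝ} (hK : 0 < K) (hq0 : 0 < q) (hq1 : q < 1)
    (hle : ∀ k, h k ≤ K * q ^ k) :
    0 < Filter.liminf (fun k : ℕ => ((-(1 / (k : ℝ)) : ℝ) : EReal) *
      ENNReal.log (ENNReal.ofReal (h k))) Filter.atTop := by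
  have hlq : 0 < -Real.log q := neg_pos.2 (Real.log_neg hq0 hq1)
  have hpos : (0 : EReal) < ((-Real.log q / 2 : ℝ) : EReal) := EReal.coe_pos.2 (half_pos hlq)
  refine hpos.trans_le (Filter.le_liminf_of_le (by isBoundedDefault) ?_)
  -- The index `0` is discarded because `1 / 0 = 0`. The second threshold makes `log K / k` at most
  -- half of `-log q`.
  filter_upwards [Filter.eventually_gt_atTop 0,
    tendsto_natCast_atTop_atTop.eventually_ge_atTop (Real.log K / (-Real.log q / 2))] with k hk hkK
  have hk' : (0 : ℝ) < k := Nat.cast_pos.2 hk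
  rw [ENNReal.log_ofReal]
  split_ifs with h0
  -- Where `h k ≤ 0` the logarithm is `⊥`, and the negative factor turns it into `⊤`.
  · rw [EReal.coe_mul_bot_of_neg (by simpa using hk)]
    exact le_top
  · push Not at h0
    rw [← EReal.coe_mul, EReal.coe_le_coe_iff]
    have h1 := Real.log_le_log h0 (hle k)
    rw [Real.log_mul hK.ne' (pow_pos hq0 k).ne', Real.log_pow] at h1
    rw [div_le_iff₀ (half_pos hlq)] at hkK
    rw [neg_mul, one_div, inv_mul_eq_div, ← neg_div, le_div_iff₀ hk']
    linarith

theorem tendsto_of_trForm_le {ι : Type*} [Fintype ι] {S : ℕ → Matrix ι ι ℂ}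
    {L : Matrix ι ι ℂ} (hS : ∀ k, (S k - L).IsHermitian) {K r : ℝ} (hr0 : 0 ≤ r)
    (hr1 : r < 1) (h : ∀ k, trForm (S k - L) (S k - L) ≤ K * r ^ k) :
    Filter.Tendsto S Filter.atTop (nhds L) := by
  refine tendsto_pi_nhds.2 fun i => tendsto_pi_nhds.2 fun j => ?_
  rw [tendsto_iff_norm_sub_tendsto_zero]
  have h0 : Filter.Tendsto (fun k : ℕ => Real.sqrt (K * r ^ k)) Filter.atTop (nhds 0) := by
    have := ((tendsto_pow_atTop_nhds_zero_of_lt_one hr0 hr1).const_mul K).sqrt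
    simpa using this
  refine squeeze_zero (fun k => norm_nonneg _) (fun k => Real.le_sqrt_of_sq_le ?_) h0
  rw [← Complex.normSq_eq_norm_sq]
  exact (normSq_apply_le_trForm_self (hS k) i j).trans (h k)

/-! ### Gibbs exponents, partial gradients and half-steps -/

section Ascent

set_option linter.unusedSectionVars false

variable {m n : Type*} [Fintype m] [DecidableEq m] [Fintype n] [DecidableEq n]
  {ε : ℝ} {ρ : Matrix m m ℂ} {σ : Matrix n n ℂ} {C : Matrix (m × n) (m × n) ℂ}
  {U U' : Matrix m m ℂ} {V V' : Matrix n n ℂ}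

theorem IsState.kronecker (hρ : IsState ρ) (hσ : IsState σ) : IsState (ρ ⊗ₖ σ) :=
  ⟨hρ.1.kronecker hσ.1, by rw [Matrix.trace_kronecker, hρ.2, hσ.2, mul_one]⟩

theorem IsState.nonempty (hρ : IsState ρ) : Nonempty m := by
  by_contra h
  rw [not_nonempty_iff] at h
  have := hρ.2
  simp [Matrix.trace] at this

/-- The exponent `(U ⊕ V - C) / ε` of the Gibbs matrix. -/
noncomputable def gibbsExponent (ε : ℝ) (C : Matrix (m × n) (m × n) ℂ) (U : Matrix m m ℂ)
    (V : Matrix n n ℂ) : Matrix (m × n) (m × n) ℂ :=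
  ε⁻¹ • (tensorSum U V - C)

theorem exp_gibbsExponent :
    NormedSpace.exp (gibbsExponent ε C U V) = gibbs ε C U V := rfl

theorem isHermitian_gibbsExponent (hC : C.IsHermitian) (hU : U.IsHermitian) (hV : V.IsHermitian) :
    (gibbsExponent ε C U V).IsHermitian :=
  ((isHermitian_tensorSum hU hV).sub hC).smul (IsSelfAdjoint.all _)

theorem isHermitian_gibbs (hC : C.IsHermitian) (hU : U.IsHermitian) (hV : V.IsHermitian) :
    (gibbs ε C U V).IsHermitian :=
  (isHermitian_gibbsExponent hC hU hV).exp

theorem gibbsExponent_sub :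
    gibbsExponent ε C U' V' - gibbsExponent ε C U V =
      tensorSum (ε⁻¹ • (U' - U)) (ε⁻¹ • (V' - V)) := by
  rw [gibbsExponent, gibbsExponent, ← smul_sub, sub_sub_sub_cancel_right, tensorSum_smul,
    tensorSum_sub]

/-- Since `ρ ⊗ σ` has marginals `ρ` and `σ`, the linear part of the dual is the pairing of `ρ ⊗ σ`
with `U ⊕ V = εA + C`. -/
theorem dual_eq (hε : 0 < ε) (hρ : IsState ρ) (hσ : IsState σ) :
    dual ε ρ σ C U V =
      trForm (ρ ⊗ₖ σ) C - ε * dualGap (ρ ⊗ₖ σ) (gibbsExponent ε C U V) := by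
  have h := trForm_tensorSum (ρ ⊗ₖ σ) U V
  rw [partialTrace₂_kronecker ρ hσ.2, partialTrace₁_kronecker σ hρ.2, trForm_comm ρ,
    trForm_comm σ, trForm_apply U, trForm_apply V] at h
  rw [dual, dualGap, exp_gibbsExponent, gibbsExponent, map_smul, map_sub, h, smul_eq_mul]
  field_simp
  ring

theorem bgaBeta_eq (hε : 0 < ε) (hρ : IsState ρ) (hσ : IsState σ) :
    bgaBeta ε ρ σ C U V = nu₂ (dualGap (ρ ⊗ₖ σ) (gibbsExponent ε C U V)) := by
  rw [bgaBeta, dual_eq hε hρ hσ, ← trForm_apply, sub_sub_cancel, mul_div_cancel_left₀ _ hε.ne']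

/-- The gradient of the dual functional with respect to the first variable. -/
noncomputable def gradLeft (ε : ℝ) (ρ : Matrix m m ℂ) (C : Matrix (m × n) (m × n) ℂ)
    (U : Matrix m m ℂ) (V : Matrix n n ℂ) : Matrix m m ℂ :=
  ρ - partialTrace₂ (gibbs ε C U V)

/-- The gradient of the dual functional with respect to the second variable. -/
noncomputable def gradRight (ε : ℝ) (σ : Matrix n n ℂ) (C : Matrix (m × n) (m × n) ℂ)
    (U : Matrix m m ℂ) (V : Matrix n n ℂ) : Matrix n n ℂ :=
  σ - partialTrace₁ (gibbs ε C U V)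

theorem isHermitian_gradLeft (hρ : IsState ρ) (hC : C.IsHermitian) (hU : U.IsHermitian)
    (hV : V.IsHermitian) : (gradLeft ε ρ C U V).IsHermitian :=
  hρ.1.isHermitian.sub (isHermitian_partialTrace₂ (isHermitian_gibbs hC hU hV))

theorem isHermitian_gradRight (hσ : IsState σ) (hC : C.IsHermitian) (hU : U.IsHermitian)
    (hV : V.IsHermitian) : (gradRight ε σ C U V).IsHermitian :=
  hσ.1.isHermitian.sub (isHermitian_partialTrace₁ (isHermitian_gibbs hC hU hV))

theorem trForm_kronecker_sub_gibbs (hρ : IsState ρ) (hσ : IsState σ) (X : Matrix m m ℂ)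
    (Y : Matrix n n ℂ) :
    trForm (ρ ⊗ₖ σ - NormedSpace.exp (gibbsExponent ε C U V)) (tensorSum X Y) =
      trForm (gradLeft ε ρ C U V) X + trForm (gradRight ε σ C U V) Y := by
  rw [exp_gibbsExponent, trForm_tensorSum, partialTrace₂_sub, partialTrace₁_sub,
    partialTrace₂_kronecker ρ hσ.2, partialTrace₁_kronecker σ hρ.2, gradLeft, gradRight]

theorem gibbsExponent_add_smul_left (hε : 0 < ε) (s : ℝ) (X : Matrix m m ℂ) :
    gibbsExponent ε C (U + (ε * s) • X) V = gibbsExponent ε C U V + s • tensorSum X 0 := by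
  rw [← sub_eq_iff_eq_add', gibbsExponent_sub, add_sub_cancel_left, sub_self, smul_smul,
    inv_mul_cancel_left₀ hε.ne', smul_zero, ← smul_zero s, tensorSum_smul, smul_zero]

theorem gibbsExponent_add_smul_right (hε : 0 < ε) (s : ℝ) (Y : Matrix n n ℂ) :
    gibbsExponent ε C U (V + (ε * s) • Y) = gibbsExponent ε C U V + s • tensorSum 0 Y := by
  rw [← sub_eq_iff_eq_add', gibbsExponent_sub, add_sub_cancel_left, sub_self, smul_smul,
    inv_mul_cancel_left₀ hε.ne', smul_zero, ← smul_zero s, tensorSum_smul, smul_zero]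

/-- The direction `g ⊕ 0` pairs with the negative gradient of the gap to `‖g‖²` and has squared norm
`card n · ‖g‖²`. The exponent thus moves by `exp (-β) / card n`, and undoing the scaling by `1/ε`
yields the step for `U`. -/
theorem dualGap_step_left_le (hε : 0 < ε) (hρ : IsState ρ) (hσ : IsState σ) (hC : C.IsHermitian)
    (hU : U.IsHermitian) (hV : V.IsHermitian) {Q : ℝ}
    (hQ : dualGap (ρ ⊗ₖ σ) (gibbsExponent ε C U V) ≤ Q) :
    dualGap (ρ ⊗ₖ σ) (gibbsExponent ε C
        (U + (ε / Fintype.card n * Real.exp (-nu₂ Q)) • gradLeft ε ρ C U V) V) ≤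
      dualGap (ρ ⊗ₖ σ) (gibbsExponent ε C U V) - Real.exp (-nu₂ Q) / Fintype.card n *
        trForm (gradLeft ε ρ C U V) (gradLeft ε ρ C U V) / 2 := by
  have hn := hσ.nonempty
  rw [show ε / Fintype.card n * Real.exp (-nu₂ Q) = ε * (Real.exp (-nu₂ Q) / Fintype.card n) by
    ring, gibbsExponent_add_smul_left hε]
  refine dualGap_step_le (isHermitian_gibbsExponent hC hU hV)
    (isHermitian_tensorSum (isHermitian_gradLeft hρ hC hU hV) Matrix.isHermitian_zero)
    (Nat.cast_pos.2 Fintype.card_pos)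
    (fun B hB h => eigenvalues_le_nu₂ (hρ.kronecker hσ) hB (h.trans hQ)) ?_ ?_
  · rw [trForm_kronecker_sub_gibbs hρ hσ, map_zero, add_zero]
  · rw [trForm_tensorSum_self _ (Matrix.trace_zero _ _), map_zero, mul_zero, add_zero]

theorem dualGap_step_right_le (hε : 0 < ε) (hρ : IsState ρ) (hσ : IsState σ) (hC : C.IsHermitian)
    (hU : U.IsHermitian) (hV : V.IsHermitian) {Q : ℝ}
    (hQ : dualGap (ρ ⊗ₖ σ) (gibbsExponent ε C U V) ≤ Q) :
    dualGap (ρ ⊗ₖ σ) (gibbsExponent ε C U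
        (V + (ε / Fintype.card m * Real.exp (-nu₂ Q)) • gradRight ε σ C U V)) ≤
      dualGap (ρ ⊗ₖ σ) (gibbsExponent ε C U V) - Real.exp (-nu₂ Q) / Fintype.card m *
        trForm (gradRight ε σ C U V) (gradRight ε σ C U V) / 2 := by
  have hm := hρ.nonempty
  rw [show ε / Fintype.card m * Real.exp (-nu₂ Q) = ε * (Real.exp (-nu₂ Q) / Fintype.card m) by
    ring, gibbsExponent_add_smul_right hε]
  refine dualGap_step_le (isHermitian_gibbsExponent hC hU hV)
    (isHermitian_tensorSum Matrix.isHermitian_zero (isHermitian_gradRight hσ hC hU hV))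
    (Nat.cast_pos.2 Fintype.card_pos)
    (fun B hB h => eigenvalues_le_nu₂ (hρ.kronecker hσ) hB (h.trans hQ)) ?_ ?_
  · rw [trForm_kronecker_sub_gibbs hρ hσ, map_zero, zero_add]
  · rw [trForm_tensorSum_zero_left_self]

/-! ### Existence and criticality of a dual optimum -/

/-- The dual gap attains its minimum on pairs of Hermitian matrices. -/
theorem exists_dualGap_minimiser (hε : 0 < ε) (hρ : IsState ρ) (hρpos : ρ.PosDef) (hσ : IsState σ)
    (hσpos : σ.PosDef) (hC : C.IsHermitian) :
    ∃ (U : Matrix m m ℂ) (V : Matrix n n ℂ), U.IsHermitian ∧ V.IsHermitian ∧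
      ∀ (U' : Matrix m m ℂ) (V' : Matrix n n ℂ), U'.IsHermitian → V'.IsHermitian →
        dualGap (ρ ⊗ₖ σ) (gibbsExponent ε C U V) ≤
          dualGap (ρ ⊗ₖ σ) (gibbsExponent ε C U' V') := by
  -- The minimum is taken over exponents rather than pairs: shifting a multiple of the identity
  -- between `U` and `V` leaves the gap unchanged, so sublevel sets of pairs are unbounded.
  set T : Set (Matrix (m × n) (m × n) ℂ) :=
    {A | ε • A + C ∈ (tensorSumSubmodule m n : Set (Matrix (m × n) (m × n) ℂ))}
  have hT : IsClosed T := isClosed_tensorSumSubmodule.preimage (by fun_prop)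
  have hmem : ∀ A ∈ T, ∃ (U : Matrix m m ℂ) (V : Matrix n n ℂ), U.IsHermitian ∧ V.IsHermitian ∧
      gibbsExponent ε C U V = A := by
    rintro A ⟨U, V, hU, hV, h⟩
    exact ⟨U, V, hU, hV, by rw [gibbsExponent, h, add_sub_cancel_right, inv_smul_smul₀ hε.ne']⟩
  have hmem' : ∀ (U : Matrix m m ℂ) (V : Matrix n n ℂ), U.IsHermitian → V.IsHermitian →
      gibbsExponent ε C U V ∈ T := fun U V hU hV =>
    ⟨U, V, hU, hV, by rw [gibbsExponent, smul_inv_smul₀ hε.ne', sub_add_cancel]⟩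
  have hTH : ∀ A ∈ T, A.IsHermitian := by
    intro A hA
    obtain ⟨U, V, hU, hV, rfl⟩ := hmem A hA
    exact isHermitian_gibbsExponent hC hU hV
  set Q := dualGap (ρ ⊗ₖ σ) (gibbsExponent ε C (0 : Matrix m m ℂ) (0 : Matrix n n ℂ))
  obtain ⟨A, hA, hmin⟩ := (isCompact_sublevel_dualGap (hρ.kronecker hσ) (hρpos.kronecker hσpos) hT
    hTH Q).exists_isMinOn
      ⟨_, hmem' 0 0 Matrix.isHermitian_zero Matrix.isHermitian_zero, le_rfl⟩
      (continuous_dualGap (ρ ⊗ₖ σ)).continuousOn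
  obtain ⟨U, V, hU, hV, rfl⟩ := hmem A hA.1
  refine ⟨U, V, hU, hV, fun U' V' hU' hV' => ?_⟩
  rcases le_total (dualGap (ρ ⊗ₖ σ) (gibbsExponent ε C U' V')) Q with h | h
  · exact hmin ⟨hmem' U' V' hU' hV', h⟩
  · exact hA.2.trans h

/-- Otherwise one gradient step from the minimiser, with `Q` its own gap, would strictly decrease
the gap. -/
theorem gradLeft_eq_zero_of_minimiser (hε : 0 < ε) (hρ : IsState ρ) (hσ : IsState σ)
    (hC : C.IsHermitian) (hU : U.IsHermitian) (hV : V.IsHermitian)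
    (hmin : ∀ (U' : Matrix m m ℂ) (V' : Matrix n n ℂ), U'.IsHermitian → V'.IsHermitian →
        dualGap (ρ ⊗ₖ σ) (gibbsExponent ε C U V) ≤
          dualGap (ρ ⊗ₖ σ) (gibbsExponent ε C U' V')) :
    gradLeft ε ρ C U V = 0 := by
  have hn := hσ.nonempty
  have hg := isHermitian_gradLeft (ε := ε) hρ hC hU hV
  have h := (hmin _ _ (isHermitian_add_smul hU hg _) hV).trans
    (dualGap_step_left_le hε hρ hσ hC hU hV le_rfl)
  refine eq_zero_of_trForm_self_le hg ?_
  by_contra! hlt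
  have hd : (0 : ℝ) < Fintype.card n := Nat.cast_pos.2 Fintype.card_pos
  linarith [mul_pos (div_pos (Real.exp_pos
    (-nu₂ (dualGap (ρ ⊗ₖ σ) (gibbsExponent ε C U V)))) hd) hlt]

theorem gradRight_eq_zero_of_minimiser (hε : 0 < ε) (hρ : IsState ρ) (hσ : IsState σ)
    (hC : C.IsHermitian) (hU : U.IsHermitian) (hV : V.IsHermitian)
    (hmin : ∀ (U' : Matrix m m ℂ) (V' : Matrix n n ℂ), U'.IsHermitian → V'.IsHermitian →
        dualGap (ρ ⊗ₖ σ) (gibbsExponent ε C U V) ≤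
          dualGap (ρ ⊗ₖ σ) (gibbsExponent ε C U' V')) :
    gradRight ε σ C U V = 0 := by
  have hm := hρ.nonempty
  have hg := isHermitian_gradRight (ε := ε) hσ hC hU hV
  have h := (hmin _ _ hU (isHermitian_add_smul hV hg _)).trans
    (dualGap_step_right_le hε hρ hσ hC hU hV le_rfl)
  refine eq_zero_of_trForm_self_le hg ?_
  by_contra! hlt
  have hd : (0 : ℝ) < Fintype.card m := Nat.cast_pos.2 Fintype.card_pos
  linarith [mul_pos (div_pos (Real.exp_pos
    (-nu₂ (dualGap (ρ ⊗ₖ σ) (gibbsExponent ε C U V)))) hd) hlt]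

/-! ### Duality through Klein's inequality -/

/-- The primal value of a coupling in terms of its relative entropy to a Gibbs matrix. -/
theorem primal_eq (hε : 0 < ε) {Γ : Matrix (m × n) (m × n) ℂ} (hΓ : IsCoupling ρ σ Γ) :
    primal ε C Γ = ε * (negEntropy Γ - trForm Γ (gibbsExponent ε C U V) +
      (NormedSpace.exp (gibbsExponent ε C U V)).trace.re - Γ.trace.re) +
        dual ε ρ σ C U V := by
  have h := trForm_tensorSum Γ U V
  rw [hΓ.2.1, hΓ.2.2, trForm_comm ρ, trForm_comm σ, trForm_apply U, trForm_apply V] at h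
  rw [primal, dual, hΓ.1.2, Complex.one_re, exp_gibbsExponent, gibbsExponent, map_smul, map_sub, h,
    ← trForm_apply C, trForm_comm C, smul_eq_mul]
  field_simp
  ring

theorem isCoupling_gibbs (hρ : IsState ρ) (hC : C.IsHermitian)
    (hU : U.IsHermitian) (hV : V.IsHermitian) (hl : gradLeft ε ρ C U V = 0)
    (hr : gradRight ε σ C U V = 0) : IsCoupling ρ σ (gibbs ε C U V) := by
  have h2 := (sub_eq_zero.1 hl).symm
  refine ⟨⟨posSemidef_exp (isHermitian_gibbsExponent hC hU hV), ?_⟩, h2, (sub_eq_zero.1 hr).symm⟩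
  rw [← trace_partialTrace₂, h2, hρ.2]

theorem primal_gibbs_eq (hε : 0 < ε) (hC : C.IsHermitian) (hU : U.IsHermitian) (hV : V.IsHermitian)
    (h : IsCoupling ρ σ (gibbs ε C U V)) :
    primal ε C (gibbs ε C U V) = dual ε ρ σ C U V := by
  have e := negEntropy_exp (isHermitian_gibbsExponent (ε := ε) hC hU hV)
  rw [primal_eq (U := U) (V := V) hε h, ← exp_gibbsExponent, e]
  ring

theorem dual_le_primal (hε : 0 < ε) (hC : C.IsHermitian) (hU : U.IsHermitian) (hV : V.IsHermitian)
    {Γ : Matrix (m × n) (m × n) ℂ} (hΓ : IsCoupling ρ σ Γ) :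
    dual ε ρ σ C U V ≤ primal ε C Γ := by
  rw [primal_eq (U := U) (V := V) hε hΓ]
  linarith [mul_nonneg hε.le (klein_nonneg hΓ.1.1 (isHermitian_gibbsExponent (ε := ε) hC hU hV))]

theorem eq_gibbs_of_primal_le (hε : 0 < ε) (hC : C.IsHermitian) (hU : U.IsHermitian)
    (hV : V.IsHermitian) {Γ : Matrix (m × n) (m × n) ℂ} (hΓ : IsCoupling ρ σ Γ)
    (h : primal ε C Γ ≤ dual ε ρ σ C U V) : Γ = gibbs ε C U V := by
  rw [primal_eq (U := U) (V := V) hε hΓ, add_le_iff_nonpos_left] at h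
  exact eq_exp_of_klein_le hΓ.1.1 (isHermitian_gibbsExponent hC hU hV)
    (nonpos_of_mul_nonpos_right h hε)

/-! ### Gradient bounds and contraction of one full step -/

/-- Strong convexity bounds the excess of the gap by the squared norm of the gradient. -/
theorem dualGap_sub_le (hρ : IsState ρ) (hσ : IsState σ) (hC : C.IsHermitian)
    (hU : U.IsHermitian) (hV : V.IsHermitian) (hU' : U'.IsHermitian) (hV' : V'.IsHermitian) {l : ℝ}
    (h : ∀ i, l ≤ (isHermitian_gibbsExponent (ε := ε) hC hU hV).eigenvalues i)
    (h' : ∀ i, l ≤ (isHermitian_gibbsExponent (ε := ε) hC hU' hV').eigenvalues i) :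
    dualGap (ρ ⊗ₖ σ) (gibbsExponent ε C U V) - dualGap (ρ ⊗ₖ σ) (gibbsExponent ε C U' V') ≤
      (trForm (gradLeft ε ρ C U V) (gradLeft ε ρ C U V) / Fintype.card n +
        trForm (gradRight ε σ C U V) (gradRight ε σ C U V) / Fintype.card m) /
          (2 * Real.exp l) := by
  have hm := hρ.nonempty
  have hn := hσ.nonempty
  have hdm : (0 : ℝ) < Fintype.card m := Nat.cast_pos.2 Fintype.card_pos
  have hdn : (0 : ℝ) < Fintype.card n := Nat.cast_pos.2 Fintype.card_pos
  have hl := Real.exp_pos l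
  have hb := le_dualGap (ω := ρ ⊗ₖ σ) _ _ h h'
  -- With `Y` traceless the squared norm of `X ⊕ Y` splits into the two blocks, and the quadratic
  -- bound can be optimised in `X` and `Y` separately.
  obtain ⟨X, Y, hX, hY, hY0, hXY⟩ := exists_tensorSum_eq_trace_zero
    (U := ε⁻¹ • (U' - U)) (V := ε⁻¹ • (V' - V))
    ((hU'.sub hU).smul (IsSelfAdjoint.all _)) ((hV'.sub hV).smul (IsSelfAdjoint.all _))
  rw [gibbsExponent_sub, ← hXY, trForm_kronecker_sub_gibbs hρ hσ,
    trForm_tensorSum_self X hY0] at hb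
  have h1 := trForm_sub_self_le (isHermitian_gradLeft (ε := ε) hρ hC hU hV) hX (mul_pos hl hdn)
  have h2 := trForm_sub_self_le (isHermitian_gradRight (ε := ε) hσ hC hU hV) hY (mul_pos hl hdm)
  have e : ∀ a d : ℝ, a / (2 * (Real.exp l * d)) = a / d / (2 * Real.exp l) := fun a d => by
    rw [div_div]; ring_nf
  rw [e] at h1 h2
  rw [add_div]
  linarith

/-- The second partial gradient changes in a controlled way under an update of the first
variable. -/
theorem trForm_gradRight_le (hε : 0 < ε) (hρ : IsState ρ) (hσ : IsState σ) (hC : C.IsHermitian)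
    (hU : U.IsHermitian) (hV : V.IsHermitian) {β : ℝ} (hU' : U'.IsHermitian)
    (hUU' : U' = U + (ε / Fintype.card n * Real.exp (-β)) • gradLeft ε ρ C U V)
    (h : ∀ i, (isHermitian_gibbsExponent (ε := ε) hC hU hV).eigenvalues i ≤ β)
    (h' : ∀ i, (isHermitian_gibbsExponent (ε := ε) hC hU' hV).eigenvalues i ≤ β) :
    trForm (gradRight ε σ C U V) (gradRight ε σ C U V) / Fintype.card m ≤
      2 * (trForm (gradRight ε σ C U' V) (gradRight ε σ C U' V) / Fintype.card m) +
        2 * (trForm (gradLeft ε ρ C U V) (gradLeft ε ρ C U V) / Fintype.card n) := by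
  have hm := hρ.nonempty
  have hn := hσ.nonempty
  have hdm : (0 : ℝ) < Fintype.card m := Nat.cast_pos.2 Fintype.card_pos
  have hdn : (0 : ℝ) < Fintype.card n := Nat.cast_pos.2 Fintype.card_pos
  set X := gibbs ε C U' V - gibbs ε C U V
  have hX : X.IsHermitian := (isHermitian_gibbs hC hU' hV).sub (isHermitian_gibbs hC hU hV)
  have h1 := trForm_partialTrace₁_self_le hX
  have h2 := trForm_exp_sub_exp_le _ _ h' h
  have e : gradRight ε σ C U V = gradRight ε σ C U' V + partialTrace₁ X := by
    rw [partialTrace₁_sub, gradRight, gradRight]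
    abel
  have h3 := trForm_self_nonneg (isHermitian_add_smul (isHermitian_gradRight (ε := ε) hσ hC hU' hV)
    (isHermitian_partialTrace₁ hX) (-1))
  have e2 : gibbsExponent ε C U' V - gibbsExponent ε C U V =
      (Real.exp (-β) / Fintype.card n) • tensorSum (gradLeft ε ρ C U V) 0 := by
    rw [hUU', show ε / Fintype.card n * Real.exp (-β) = ε * (Real.exp (-β) / Fintype.card n) by
      ring, gibbsExponent_add_smul_left hε, add_sub_cancel_left]
  -- The Lipschitz factor `exp (2β)` cancels the squared step: `exp (2β) · (exp (-β) / d)² · d‖g‖² =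
  -- ‖g‖² / d` with `d = card n`.
  have h4 : trForm X X ≤
      trForm (gradLeft ε ρ C U V) (gradLeft ε ρ C U V) / Fintype.card n := by
    refine h2.trans (le_of_eq ?_)
    rw [e2]
    simp only [map_smul, LinearMap.smul_apply, smul_eq_mul]
    rw [trForm_tensorSum_self _ (Matrix.trace_zero _ _), map_zero, mul_zero, add_zero, Real.exp_neg]
    field_simp
  have h5 : trForm (partialTrace₁ X) (partialTrace₁ X) / Fintype.card m ≤
      trForm (gradLeft ε ρ C U V) (gradLeft ε ρ C U V) / Fintype.card n := by
    rw [div_le_iff₀ hdm, mul_comm]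
    exact h1.trans (mul_le_mul_of_nonneg_left h4 hdm.le)
  -- This is `‖a + b‖² ≤ 2‖a‖² + 2‖b‖²`, from `‖a - b‖² ≥ 0`.
  have h6 : trForm (gradRight ε σ C U V) (gradRight ε σ C U V) ≤
      2 * trForm (gradRight ε σ C U' V) (gradRight ε σ C U' V) +
        2 * trForm (partialTrace₁ X) (partialTrace₁ X) := by
    rw [e]
    simp only [map_add, LinearMap.add_apply, map_smul, LinearMap.smul_apply, smul_eq_mul] at h3 ⊢
    linarith
  have h7 := div_le_div_of_nonneg_right h6 hdm.le
  rw [add_div, mul_div_assoc, mul_div_assoc] at h7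
  linarith

theorem bga_succ (U₀ : Matrix m m ℂ) (V₀ : Matrix n n ℂ) (k : ℕ) :
    (bga ε ρ σ C U₀ V₀ (k + 1)).1 = (bga ε ρ σ C U₀ V₀ k).1 +
      (ε / Fintype.card n * Real.exp (-bgaBeta ε ρ σ C U₀ V₀)) •
        gradLeft ε ρ C (bga ε ρ σ C U₀ V₀ k).1 (bga ε ρ σ C U₀ V₀ k).2 ∧
    (bga ε ρ σ C U₀ V₀ (k + 1)).2 = (bga ε ρ σ C U₀ V₀ k).2 +
      (ε / Fintype.card m * Real.exp (-bgaBeta ε ρ σ C U₀ V₀)) •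
        gradRight ε σ C (bga ε ρ σ C U₀ V₀ (k + 1)).1 (bga ε ρ σ C U₀ V₀ k).2 := ⟨rfl, rfl⟩

theorem isHermitian_bga (hρ : IsState ρ) (hσ : IsState σ) (hC : C.IsHermitian)
    (hU : U.IsHermitian) (hV : V.IsHermitian) (k : ℕ) :
    (bga ε ρ σ C U V k).1.IsHermitian ∧ (bga ε ρ σ C U V k).2.IsHermitian := by
  induction k with
  | zero => exact ⟨hU, hV⟩
  | succ k ih =>
    obtain ⟨h1, h2⟩ := bga_succ (ε := ε) (ρ := ρ) (σ := σ) (C := C) U V k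
    have h : (bga ε ρ σ C U V (k + 1)).1.IsHermitian := by
      rw [h1]
      exact isHermitian_add_smul ih.1 (isHermitian_gradLeft hρ hC ih.1 ih.2) _
    refine ⟨h, ?_⟩
    rw [h2]
    exact isHermitian_add_smul ih.2 (isHermitian_gradRight hσ hC h ih.2) _

/-- One full step of the method contracts the excess of the gap over its value at any competitor in
the sublevel set. -/
theorem dualGap_bga_succ_le (hε : 0 < ε) (hρ : IsState ρ) (hσ : IsState σ) (hC : C.IsHermitian)
    (hU : U.IsHermitian) (hV : V.IsHermitian) {c : ℝ} (hc : 0 < c)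
    (hωc : ∀ i, c ≤ (hρ.kronecker hσ).1.isHermitian.eigenvalues i) {Q : ℝ}
    (hQ : Q = dualGap (ρ ⊗ₖ σ) (gibbsExponent ε C U V)) {k : ℕ}
    (hk : dualGap (ρ ⊗ₖ σ) (gibbsExponent ε C (bga ε ρ σ C U V k).1 (bga ε ρ σ C U V k).2) ≤ Q)
    (hU' : U'.IsHermitian) (hV' : V'.IsHermitian)
    (hQ' : dualGap (ρ ⊗ₖ σ) (gibbsExponent ε C U' V') ≤ Q) :
    dualGap (ρ ⊗ₖ σ) (gibbsExponent ε C (bga ε ρ σ C U V (k + 1)).1 (bga ε ρ σ C U V (k + 1)).2) ≤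
      dualGap (ρ ⊗ₖ σ) (gibbsExponent ε C (bga ε ρ σ C U V k).1 (bga ε ρ σ C U V k).2) ∧
    dualGap (ρ ⊗ₖ σ) (gibbsExponent ε C (bga ε ρ σ C U V k).1 (bga ε ρ σ C U V k).2) -
        dualGap (ρ ⊗ₖ σ) (gibbsExponent ε C U' V') ≤
      3 * Real.exp (nu₂ Q) / Real.exp (-(Q / c) - 1) *
        (dualGap (ρ ⊗ₖ σ) (gibbsExponent ε C (bga ε ρ σ C U V k).1 (bga ε ρ σ C U V k).2) -
          dualGap (ρ ⊗ₖ σ) (gibbsExponent ε C (bga ε ρ σ C U V (k + 1)).1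
            (bga ε ρ σ C U V (k + 1)).2)) := by
  obtain ⟨h1, h2⟩ := bga_succ (ε := ε) (ρ := ρ) (σ := σ) (C := C) U V k
  have hH := isHermitian_bga (ε := ε) hρ hσ hC hU hV k
  have hH' := isHermitian_bga (ε := ε) hρ hσ hC hU hV (k + 1)
  rw [bgaBeta_eq hε hρ hσ, ← hQ] at h1 h2
  set Uk := (bga ε ρ σ C U V k).1
  set Vk := (bga ε ρ σ C U V k).2
  set Uk' := (bga ε ρ σ C U V (k + 1)).1
  set Vk' := (bga ε ρ σ C U V (k + 1)).2
  have hω := hρ.kronecker hσ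
  have hm := hρ.nonempty
  have hn := hσ.nonempty
  have hdm : (0 : ℝ) < Fintype.card m := Nat.cast_pos.2 Fintype.card_pos
  have hdn : (0 : ℝ) < Fintype.card n := Nat.cast_pos.2 Fintype.card_pos
  have s1 := dualGap_step_left_le hε hρ hσ hC hH.1 hH.2 hk
  rw [← h1] at s1
  have n1 := div_nonneg (trForm_self_nonneg (isHermitian_gradLeft (ε := ε) hρ hC hH.1 hH.2)) hdn.le
  have n2 := div_nonneg (trForm_self_nonneg (isHermitian_gradRight (ε := ε) hσ hC hH'.1 hH.2))
    hdm.le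
  rw [div_mul_eq_mul_div, mul_div_assoc] at s1
  have hs := Real.exp_pos (-nu₂ Q)
  have hk2 : dualGap (ρ ⊗ₖ σ) (gibbsExponent ε C Uk' Vk) ≤ Q := by
    linarith [mul_nonneg hs.le n1]
  have s2 := dualGap_step_right_le hε hρ hσ hC hH'.1 hH.2 hk2
  rw [← h2, div_mul_eq_mul_div, mul_div_assoc] at s2
  have pl := dualGap_sub_le hρ hσ hC hH.1 hH.2 hU' hV' (le_eigenvalues hω _ hc hωc hk)
    (le_eigenvalues hω _ hc hωc hQ')
  have gr := trForm_gradRight_le hε hρ hσ hC hH.1 hH.2 hH'.1 h1 (eigenvalues_le_nu₂ hω _ hk)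
    (eigenvalues_le_nu₂ hω _ hk2)
  set a := trForm (gradLeft ε ρ C Uk Vk) (gradLeft ε ρ C Uk Vk) / Fintype.card n
  set b := trForm (gradRight ε σ C Uk' Vk) (gradRight ε σ C Uk' Vk) / Fintype.card m
  have hl := Real.exp_pos (-(Q / c) - 1)
  have i1 := mul_nonneg hs.le n1
  have i2 := mul_nonneg hs.le n2
  refine ⟨by linarith, pl.trans ?_⟩
  -- The right gradient at the old `U` contributes at most `2a + 2b`, so the total is `3a + 2b ≤ 3
  -- (a + b)`; the two half-steps decrease the gap by at least `exp (-β) (a + b) / 2`.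
  calc _ ≤ (3 * (a + b)) / (2 * Real.exp (-(Q / c) - 1)) := by
        gcongr
        linarith
    _ = 3 * Real.exp (nu₂ Q) / Real.exp (-(Q / c) - 1) *
        (Real.exp (-nu₂ Q) * a / 2 + Real.exp (-nu₂ Q) * b / 2) := by
        rw [Real.exp_neg]
        field_simp
    _ ≤ _ := by
        gcongr
        linarith

/-- Adding the two hypotheses gives `(K + 1) δ (k + 1) ≤ K δ k`. Using monotonicity in this way
keeps the ratio in `(0, 1)` for every `K > 0`. -/
theorem geometric_decay {δ : ℕ → ℝ} {K : ℝ} (hK : 0 < K)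
    (h : ∀ k, δ k ≤ K * (δ k - δ (k + 1)) ∧ δ (k + 1) ≤ δ k) (k : ℕ) :
    δ k ≤ δ 0 * (K / (K + 1)) ^ k := by
  induction k with
  | zero => simp
  | succ k ih =>
    obtain ⟨h1, h2⟩ := h k
    have h3 : δ (k + 1) ≤ K / (K + 1) * δ k := by
      rw [div_mul_eq_mul_div, le_div_iff₀ (by linarith)]
      linarith
    refine h3.trans ?_
    rw [pow_succ, ← mul_assoc, mul_comm]
    exact mul_le_mul_of_nonneg_right ih (by positivity)

end Ascent

/-! ### Linear convergence of exponents and Gibbs matrices -/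

section Convergence

variable {m n : Type*} [Fintype m] [DecidableEq m] [Fintype n] [DecidableEq n]
  {ε : ℝ} {ρ : Matrix m m ℂ} {σ : Matrix n n ℂ} {C : Matrix (m × n) (m × n) ℂ}
  {U U₀ : Matrix m m ℂ} {V V₀ : Matrix n n ℂ}

/-- Linear convergence of the exponents and of the Gibbs matrices towards those of a critical
minimiser of the gap. -/
theorem exists_linear_rate (hε : 0 < ε) (hρ : IsState ρ) (hρpos : ρ.PosDef) (hσ : IsState σ)
    (hσpos : σ.PosDef) (hC : C.IsHermitian) (hU₀ : U₀.IsHermitian) (hV₀ : V₀.IsHermitian)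
    (hU : U.IsHermitian) (hV : V.IsHermitian)
    (hmin : ∀ (U' : Matrix m m ℂ) (V' : Matrix n n ℂ), U'.IsHermitian → V'.IsHermitian →
      dualGap (ρ ⊗ₖ σ) (gibbsExponent ε C U V) ≤ dualGap (ρ ⊗ₖ σ) (gibbsExponent ε C U' V'))
    (hl : gradLeft ε ρ C U V = 0) (hr : gradRight ε σ C U V = 0) :
    ∃ K r : ℝ, 0 < K ∧ 0 < r ∧ r < 1 ∧ ∀ k,
      trForm (gibbsExponent ε C (bga ε ρ σ C U₀ V₀ k).1 (bga ε ρ σ C U₀ V₀ k).2 -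
          gibbsExponent ε C U V)
        (gibbsExponent ε C (bga ε ρ σ C U₀ V₀ k).1 (bga ε ρ σ C U₀ V₀ k).2 -
          gibbsExponent ε C U V) ≤ K * r ^ k ∧
      trForm (gibbs ε C (bga ε ρ σ C U₀ V₀ k).1 (bga ε ρ σ C U₀ V₀ k).2 - gibbs ε C U V)
        (gibbs ε C (bga ε ρ σ C U₀ V₀ k).1 (bga ε ρ σ C U₀ V₀ k).2 - gibbs ε C U V) ≤
          K * r ^ k := by
  have hω := hρ.kronecker hσ
  obtain ⟨c, hc, hωc⟩ := exists_pos_le_eigenvalues (hρpos.kronecker hσpos)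
  have hH := isHermitian_bga (ε := ε) hρ hσ hC hU₀ hV₀
  set Q := dualGap (ρ ⊗ₖ σ) (gibbsExponent ε C U₀ V₀) with hQ
  set A := fun k => gibbsExponent ε C (bga ε ρ σ C U₀ V₀ k).1 (bga ε ρ σ C U₀ V₀ k).2
  set L := gibbsExponent ε C U V
  have hA : ∀ k, (A k).IsHermitian := fun k => isHermitian_gibbsExponent hC (hH k).1 (hH k).2
  have hL : L.IsHermitian := isHermitian_gibbsExponent hC hU hV
  have hLQ : dualGap (ρ ⊗ₖ σ) L ≤ Q := hmin _ _ hU₀ hV₀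
  have hAQ : ∀ k, dualGap (ρ ⊗ₖ σ) (A k) ≤ Q := by
    intro k
    induction k with
    | zero => exact le_rfl
    | succ k ih =>
      exact (dualGap_bga_succ_le hε hρ hσ hC hU₀ hV₀ hc hωc hQ ih hU hV hLQ).1.trans ih
  set M := 3 * Real.exp (nu₂ Q) / Real.exp (-(Q / c) - 1)
  have hM : 0 < M := by positivity
  have decay := geometric_decay (δ := fun k => dualGap (ρ ⊗ₖ σ) (A k) - dualGap (ρ ⊗ₖ σ) L) hM
    fun k => by
      obtain ⟨h1, h2⟩ := dualGap_bga_succ_le hε hρ hσ hC hU₀ hV₀ hc hωc hQ (hAQ k) hU hV hLQ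
      exact ⟨by simpa using h2, sub_le_sub_right h1 _⟩
  set D := dualGap (ρ ⊗ₖ σ) (A 0) - dualGap (ρ ⊗ₖ σ) L
  have hD : 0 ≤ D := sub_nonneg.2 hLQ
  set μ := Real.exp (-(Q / c) - 1)
  have hμ : 0 < μ := Real.exp_pos _
  have strong : ∀ k, trForm (A k - L) (A k - L) ≤ 2 / μ * D * (M / (M + 1)) ^ k := by
    intro k
    have h := le_dualGap (ω := ρ ⊗ₖ σ) hL (hA k) (le_eigenvalues hω hL hc hωc hLQ)
      (le_eigenvalues hω (hA k) hc hωc (hAQ k))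
    -- The minimiser is critical along tensor sums, so the linear term of the strong convexity bound
    -- vanishes.
    have h0 : trForm (ρ ⊗ₖ σ - NormedSpace.exp L) (A k - L) = 0 := by
      rw [gibbsExponent_sub, trForm_kronecker_sub_gibbs hρ hσ, hl, hr]
      simp
    rw [h0, sub_zero] at h
    rw [mul_assoc, div_mul_eq_mul_div, le_div_iff₀ hμ]
    linarith [decay k]
  set E := Real.exp (nu₂ Q) ^ 2
  have hE : 0 < E := by positivity
  have hq : ∀ k, 0 ≤ (M / (M + 1)) ^ k := fun k => by positivity
  have hK : 0 ≤ 2 / μ * D := by positivity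
  -- The factor `E + 1` serves both bounds; the final `+ 1` keeps the constant positive when the
  -- initial excess `D` is zero.
  refine ⟨(E + 1) * (2 / μ * D) + 1, M / (M + 1), by positivity, by positivity,
    (div_lt_one (by linarith)).2 (by linarith), fun k => ⟨(strong k).trans ?_, ?_⟩⟩
  · refine mul_le_mul_of_nonneg_right ?_ (hq k)
    nlinarith [mul_nonneg hE.le hK]
  · refine (trForm_exp_sub_exp_le (hA k) hL (eigenvalues_le_nu₂ hω _ (hAQ k))
      (eigenvalues_le_nu₂ hω _ hLQ)).trans ?_
    refine (mul_le_mul_of_nonneg_left (strong k) hE.le).trans ?_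
    rw [← mul_assoc]
    refine mul_le_mul_of_nonneg_right ?_ (hq k)
    linarith

end Convergence

end QOT

theorem mainTheorem1 {m n : Type*} [Fintype m] [DecidableEq m] [Fintype n] [DecidableEq n]
    (ε : ℝ) (hε : 0 < ε)
    (ρ : Matrix m m ℂ) (hρ : QOT.IsState ρ) (hρpos : ρ.PosDef)
    (σ : Matrix n n ℂ) (hσ : QOT.IsState σ) (hσpos : σ.PosDef)
    (C : Matrix (m × n) (m × n) ℂ) (hC : C.IsHermitian)
    (U₀ : Matrix m m ℂ) (hU₀ : U₀.IsHermitian) (V₀ : Matrix n n ℂ) (hV₀ : V₀.IsHermitian) :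
    ∃ (U : Matrix m m ℂ) (V : Matrix n n ℂ), U.IsHermitian ∧ V.IsHermitian ∧
      Filter.Tendsto
        (fun k : ℕ => QOT.tensorSum (QOT.bga ε ρ σ C U₀ V₀ k).1 (QOT.bga ε ρ σ C U₀ V₀ k).2)
        Filter.atTop (nhds (QOT.tensorSum U V)) ∧
      QOT.IsDualMaximiser ε ρ σ C U V ∧
      QOT.IsPrimalMinimiser ε ρ σ C (QOT.gibbs ε C U V) ∧
      (∀ Γ : Matrix (m × n) (m × n) ℂ,
        QOT.IsPrimalMinimiser ε ρ σ C Γ → Γ = QOT.gibbs ε C U V) ∧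
      -- the logarithm takes values in the extended reals, with value `⊥` at `0`
      0 < Filter.liminf
        (fun k : ℕ => ((-(1 / (k : ℝ)) : ℝ) : EReal) *
          ENNReal.log (ENNReal.ofReal (QOT.hsNorm
            (QOT.gibbs ε C (QOT.bga ε ρ σ C U₀ V₀ k).1 (QOT.bga ε ρ σ C U₀ V₀ k).2 -
              QOT.gibbs ε C U V))))
        Filter.atTop := by
  obtain ⟨U, V, hU, hV, hmin⟩ := QOT.exists_dualGap_minimiser hε hρ hρpos hσ hσpos hC
  have hl := QOT.gradLeft_eq_zero_of_minimiser hε hρ hσ hC hU hV hmin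
  have hr := QOT.gradRight_eq_zero_of_minimiser hε hρ hσ hC hU hV hmin
  obtain ⟨K, r, hK, hr0, hr1, hrate⟩ := QOT.exists_linear_rate hε hρ hρpos hσ hσpos hC hU₀ hV₀
    hU hV hmin hl hr
  have hH := QOT.isHermitian_bga (ε := ε) hρ hσ hC hU₀ hV₀
  have hcoup := QOT.isCoupling_gibbs hρ hC hU hV hl hr
  have hval := QOT.primal_gibbs_eq hε hC hU hV hcoup
  refine ⟨U, V, hU, hV, ?_, ⟨hU, hV, fun U' V' hU' hV' => ?_⟩,
    ⟨hcoup, fun Γ hΓ => hval.trans_le (QOT.dual_le_primal hε hC hU hV hΓ)⟩,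
    fun Γ hΓ => QOT.eq_gibbs_of_primal_le hε hC hU hV hΓ.1 ((hΓ.2 _ hcoup).trans hval.le), ?_⟩
  · have h := QOT.tendsto_of_trForm_le (fun k =>
      (QOT.isHermitian_gibbsExponent (ε := ε) hC (hH k).1 (hH k).2).sub
        (QOT.isHermitian_gibbsExponent hC hU hV)) hr0.le hr1 fun k => (hrate k).1
    -- Convergence of the exponents is carried back by `U ⊕ V = εA + C`.
    simpa [QOT.gibbsExponent, smul_inv_smul₀ hε.ne'] using (h.const_smul ε).add_const C
  · rw [QOT.dual_eq hε hρ hσ, QOT.dual_eq hε hρ hσ]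
    exact sub_le_sub_left (mul_le_mul_of_nonneg_left (hmin U' V' hU' hV') hε.le) _
  -- The rate bounds the squared norm, so constant and ratio enter through their square roots.
  · refine QOT.liminf_neg_log_pos (Real.sqrt_pos.2 hK) (Real.sqrt_pos.2 hr0)
      ((Real.sqrt_lt' one_pos).2 (by simpa using hr1)) fun k => ?_
    rw [QOT.hsNorm_eq ((QOT.isHermitian_gibbs hC (hH k).1 (hH k).2).sub
      (QOT.isHermitian_gibbs hC hU hV)), Real.sqrt_le_left (by positivity), mul_pow, ← pow_mul,
      mul_comm k, pow_mul, Real.sq_sqrt hK.le, Real.sq_sqrt hr0.le]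
    exact (hrate k).2
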